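/- For $n\ge 0$ let $H_n$ be the Hermite polynomial $H_n(t)=n!\sum_{\ell=0}^{\lfloor n/2\rfloor}\frac{(-1)^\ell}{\ell!\,(n-2\ell)!}(2t)^{n-2\ell}$, and for $\rho>0$ let $\|f\|_{L^2(\mathbb R,\rho)}^2:=\int_{-\infty}^{\infty}|f(t)|^2\,\mathrm e^{-t^2/(2\rho)}\,\mathrm dt$. For every $\rho>0$ there is a constant $c>0$, depending only on $\rho$, such that the following holds for every $\sigma>0$, with $r:=\rho/\sigma$. (a) Let $N\ge 1$, let $t_1>t_2>\dots>t_N$ be the zeros of $H_N$, and put $\lambda_j:=-\mathrm i\sqrt{\frac{2(\rho+\sigma)}{\sigma(2\rho+\sigma)}}\;t_j$ for $j=1,\dots,N$. Then the linear system $$\sum_{j=1}^{N}\mathrm e^{(\lambda_j-\lambda_k)^2\rho/2}\,\gamma_j=\sqrt{\frac{\sigma}{\sigma+\rho}}\;\mathrm e^{\frac{\sigma\rho\lambda_k^2}{2(\sigma+\rho)}},\qquad k=1,\dots,N,$$ has exactly one solution $(\gamma_1,\dots,\gamma_N)\in\mathbb C^N$. It satisfies $\gamma_j=\gamma_{N+1-j}$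 for $j=1,\dots,N$, the function $t\mapsto \mathrm e^{-t^2/(2\sigma)}-\sum_{j=1}^N\gamma_j\mathrm e^{\lambda_j t}$ belongs to $L^2(\mathbb R,\rho)$, and $$\Big\|\mathrm e^{-\cdot^2/(2\sigma)}-\sum_{j=1}^N\gamma_j\,\mathrm e^{\lambda_j\cdot}\Big\|_{L^2(\mathbb R,\rho)}<c\left(\frac{r}{\sqrt{2(2r+1)}}\right)^{N}N^{3/4}\le c\left(\frac{3^{1/4}\,r}{\sqrt{2(2r+1)}}\right)^{N},$$ where the second inequality is strict for every $N\neq 3$. (b) If $r<2+\sqrt6$, the error decays exponentially in $N$: there are $C>0$ and $q\in(0,1)$ (depending on $\rho$ and $\sigma$, but not on $N$) such that, for every $N\ge1$ and with $\lambda_j,\gamma_j$ as in (a), $$\Big\|\mathrm e^{-\cdot^2/(2\sigma)}-\sum_{j=1}^N\gamma_j\,\mathrm e^{\lambda_j\cdot}\Big\|_{L^2(\mathbb R,\rho)}\le C\,q^{N}.$$ -/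

import Mathlib

/-- The Hermite polynomials orthogonal for the weight `exp (-t ^ 2)` (physicists' normalization,
leading coefficient `2 ^ n`), by the recursion `H_{n+1}(t) = 2 t H_n(t) - H_n'(t)`. -/
noncomputable def hermiteH : ℕ → Polynomial ℝ
  | 0 => 1
  | n + 1 => 2 * Polynomial.X * hermiteH n - Polynomial.derivative (hermiteH n)

/-- `t 0 > t 1 > ⋯ > t (N - 1)` is the decreasing enumeration of all zeros of `H_N`. -/
def IsHermiteZeros (N : ℕ) (t : Fin N → ℝ) : Prop :=
  StrictAnti t ∧ ∀ x : ℝ, (hermiteH N).eval x = 0 ↔ ∃ j, t j = x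

/-- The frequencies `λ_j = - i √(2 (ρ + σ) / (σ (2 ρ + σ))) t_j`. -/
noncomputable def frequency (ρ σ : ℝ) {N : ℕ} (t : Fin N → ℝ) (j : Fin N) : ℂ :=
  -Complex.I * (Real.sqrt (2 * (ρ + σ) / (σ * (2 * ρ + σ))) : ℂ) * (t j : ℂ)

/-- `γ` solves the linear system by which the algorithm computes the coefficients belonging to
the frequencies `lam`. -/
def SolvesCoefficientSystem (ρ σ : ℝ) {N : ℕ} (lam γ : Fin N → ℂ) : Prop :=
  ∀ k : Fin N,
    ∑ j : Fin N, Complex.exp ((lam j - lam k) ^ 2 * ρ / 2) * γ j =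
      (Real.sqrt (σ / (σ + ρ)) : ℂ) * Complex.exp (σ * ρ * lam k ^ 2 / (2 * (σ + ρ)))

/-- The difference `t ↦ exp (-t ^ 2 / (2 σ)) - ∑ j, γ_j exp (λ_j t)`. -/
noncomputable def approxResidual (σ : ℝ) {N : ℕ} (lam γ : Fin N → ℂ) (t : ℝ) : ℂ :=
  (Real.exp (-t ^ 2 / (2 * σ)) : ℂ) - ∑ j : Fin N, γ j * Complex.exp (lam j * t)

/-- Membership in the weighted space `L²(ℝ, ρ)` with weight `exp (-t ^ 2 / (2 ρ))`. -/
def MemWeightedL2 (ρ : ℝ) (f : ℝ → ℂ) : Prop :=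
  MeasureTheory.AEStronglyMeasurable f MeasureTheory.volume ∧
    MeasureTheory.Integrable (fun t : ℝ => ‖f t‖ ^ 2 * Real.exp (-t ^ 2 / (2 * ρ)))
      MeasureTheory.volume

/-- The norm of `L²(ℝ, ρ)`: `‖f‖² = ∫ |f t|² exp (-t ^ 2 / (2 ρ)) dt`. -/
noncomputable def weightedL2Norm (ρ : ℝ) (f : ℝ → ℂ) : ℝ :=
  Real.sqrt (∫ t : ℝ, ‖f t‖ ^ 2 * Real.exp (-t ^ 2 / (2 * ρ)))

/-!
The frequencies `λ_j` are purely imaginary, so the coefficient system consists of the normal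
equations of best approximation in `L²(ℝ, ρ)`: its matrix is the Gram matrix of the exponentials
`exp (λ_j x)` up to a scalar, and it is invertible because distinct exponentials are linearly
independent. The solution therefore has the smallest error among all coefficient vectors
(`weightedNormSq_approxResidual_le`), and it suffices to exhibit one good vector.

Put `η = ρ / (ρ + σ)`, so that `(r / √(2 (2 r + 1)))² = η² / (2 (1 - η²))`. Only the case
in which this number is below `1` needs an argument: otherwise the zero vector will do.
The vector used is `quadCoefficient`, the Gauss–Hermite weights `w_j` (normalized to sum `1`) times
a Gaussian factor. By a computation with Gaussian integrals its squared error is a constant times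
`∑ⱼ ∑ₗ w_j w_l M_η(t_j, t_l) - 1`, where `M_η` is Mehler's kernel
(`weightedNormSq_quadCoefficient`). By Mehler's formula this number equals
`∑_{n ≥ 1} ηⁿ Q(H_n)² / (2ⁿ n!)` with `Q` the quadrature rule; the terms with `n < 2 N` vanish by
exactness of `Q`, and the terms with odd `n` by symmetry.

For `n = 2 N + 2 k` there are two bounds for `Q(H_n)² / (2ⁿ n!)`. Since
`|H_n(x)| ≤ C (2ⁿ n!)^{1/2} (n+2)^{1/4} exp (x² / 2)` (which is read off from the diagonal of
Mehler's formula) and `Q` integrates `exp (x² / 2)` to a bounded value, it is `O(√n)`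
(`abs_quadSum_hermiteH_le`).
Since the quadrature error is a positive functional of the `2 N`-th derivative (`quadError_nonneg`,
by Rolle's theorem) and `H_n^{(2N)}` is a multiple of `H_{2k}`, it is
`O(√n · C(2N+2k, 2k) / C(2N, N))` (`abs_quadSum_hermiteH_add_le`); the moments of that positive
functional are controlled by a three-term recursion (`quadError_X_pow_mul_hermiteH_bounds`). The
geometric mean of the two bounds is `O(N · 2⁻ᴺ C(N+1+k, k))` (`sq_quadSum_hermiteH_le`), and the
binomial series gives the squared error `O(N (η² / (2 (1 - η²)))ᴺ)`, uniformly in `σ`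
(`sum_quadWeight_mehlerKernel_le`).
-/

open Polynomial

/-! ### Hermite polynomials and the Gaussian mean -/

theorem derivative_hermiteH_succ (n : ℕ) :
    derivative (hermiteH (n + 1)) = C (2 * (n + 1 : ℝ)) * hermiteH n := by
  induction n with
  | zero =>
    simp [hermiteH]
    rfl
  | succ n ih =>
    have h1 : hermiteH (n + 1 + 1) =
        2 * X * hermiteH (n + 1) - derivative (hermiteH (n + 1)) := rfl
    have h2 : hermiteH (n + 1) = 2 * X * hermiteH n - derivative (hermiteH n) := rfl
    have h3 : derivative (hermiteH n) = 2 * X * hermiteH n - hermiteH (n + 1) := by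
      rw [h2]; ring
    rw [h1, derivative_sub, derivative_mul, ih, derivative_mul, derivative_mul, derivative_C, h3]
    simp only [derivative_X, map_mul, map_add, map_ofNat, map_natCast, map_one, Nat.cast_add,
      Nat.cast_one, derivative_ofNat]
    ring

theorem hermiteH_succ_succ (n : ℕ) :
    hermiteH (n + 2) = 2 * X * hermiteH (n + 1) - C (2 * (n + 1 : ℝ)) * hermiteH n := by
  rw [← derivative_hermiteH_succ]; rfl

theorem derivative_hermiteH (n : ℕ) :
    derivative (hermiteH n) = C (2 * (n : ℝ)) * hermiteH (n - 1) := by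
  cases n with
  | zero => simp [hermiteH]
  | succ n => rw [derivative_hermiteH_succ]; simp

theorem X_mul_hermiteH (n : ℕ) :
    X * hermiteH n = C (1 / 2 : ℝ) * hermiteH (n + 1) + C (n : ℝ) * hermiteH (n - 1) := by
  have h : hermiteH (n + 1) = 2 * X * hermiteH n - derivative (hermiteH n) := rfl
  rw [h, derivative_hermiteH]
  have h2 : (C (1 / 2 : ℝ) : ℝ[X]) * 2 = 1 := by
    rw [← C_ofNat, ← C_mul]; norm_num
  simp only [map_mul, map_ofNat]
  linear_combination (-(X * hermiteH n) + C (n : ℝ) * hermiteH (n - 1)) * h2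

theorem hermiteH_natDegree_and_coeff (n : ℕ) :
    (hermiteH n).natDegree ≤ n ∧ (hermiteH n).coeff n = 2 ^ n := by
  induction n with
  | zero => simp [hermiteH]
  | succ n ih =>
    have h : hermiteH (n + 1) = C 2 * (X * hermiteH n) - derivative (hermiteH n) := by
      rw [← mul_assoc]; rfl
    constructor
    · rw [h]
      refine (natDegree_sub_le _ _).trans (max_le ?_ ?_)
      · refine (natDegree_C_mul_le _ _).trans (natDegree_mul_le.trans ?_)
        rw [natDegree_X]; omega
      · exact (natDegree_derivative_le _).trans (by omega)
    · rw [h, coeff_sub, coeff_C_mul, coeff_X_mul, ih.2, coeff_derivative,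
        coeff_eq_zero_of_natDegree_lt (by omega)]
      ring

theorem hermiteH_natDegree (n : ℕ) : (hermiteH n).natDegree = n :=
  le_antisymm (hermiteH_natDegree_and_coeff n).1
    (le_natDegree_of_ne_zero (by rw [(hermiteH_natDegree_and_coeff n).2]; positivity))

theorem hermiteH_leadingCoeff (n : ℕ) : (hermiteH n).leadingCoeff = 2 ^ n := by
  rw [leadingCoeff, hermiteH_natDegree, (hermiteH_natDegree_and_coeff n).2]

theorem hermiteH_ne_zero (n : ℕ) : hermiteH n ≠ 0 := by
  intro h
  have := hermiteH_leadingCoeff n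
  rw [h, leadingCoeff_zero] at this
  exact (pow_ne_zero n two_ne_zero) this.symm

theorem eval_neg_hermiteH (n : ℕ) (x : ℝ) :
    (hermiteH n).eval (-x) = (-1) ^ n * (hermiteH n).eval x := by
  induction n using Nat.twoStepInduction with
  | zero => simp [hermiteH]
  | one => simp [hermiteH]
  | more n h1 h2 =>
    rw [hermiteH_succ_succ]
    simp only [eval_sub, eval_mul, eval_X, eval_C, eval_ofNat, h1, h2]
    ring

theorem iterate_derivative_hermiteH (k n : ℕ) :
    derivative^[k] (hermiteH (n + k)) =
      C (2 ^ k * ((n + k).descFactorial k : ℝ)) * hermiteH n := by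
  induction k generalizing n with
  | zero => simp
  | succ k ih =>
    rw [Function.iterate_succ_apply', show n + (k + 1) = (n + 1) + k by ring, ih,
      derivative_C_mul, derivative_hermiteH_succ, ← mul_assoc, ← C_mul]
    congr 2
    rw [Nat.descFactorial_succ, show n + 1 + k - k = n + 1 by omega]
    push_cast; ring

theorem integrable_pow_mul_exp_neg_sq (n : ℕ) :
    MeasureTheory.Integrable (fun x : ℝ => x ^ n * Real.exp (-x ^ 2)) := by
  have h := integrable_rpow_mul_exp_neg_mul_sq (b := 1) one_pos (s := n)
    (by have : (0 : ℝ) ≤ n := n.cast_nonneg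
        linarith)
  simpa [Real.rpow_natCast] using h

theorem integrable_eval_mul_exp_neg_sq (p : ℝ[X]) :
    MeasureTheory.Integrable (fun x : ℝ => p.eval x * Real.exp (-x ^ 2)) := by
  have : (fun x : ℝ => p.eval x * Real.exp (-x ^ 2)) = fun x =>
      ∑ i ∈ Finset.range (p.natDegree + 1), p.coeff i * (x ^ i * Real.exp (-x ^ 2)) := by
    ext x
    rw [eval_eq_sum_range, Finset.sum_mul]
    exact Finset.sum_congr rfl fun i _ => by ring
  rw [this]
  exact MeasureTheory.integrable_finsetSum _ fun i _ =>
    (integrable_pow_mul_exp_neg_sq i).const_mul _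

/-- The mean of a polynomial under the Gaussian probability measure `π^{-1/2} exp (-x²) dx`. -/
noncomputable def gaussianMean : ℝ[X] →ₗ[ℝ] ℝ where
  toFun p := (Real.sqrt Real.pi)⁻¹ * ∫ x : ℝ, p.eval x * Real.exp (-x ^ 2)
  map_add' p q := by
    simp only [eval_add, add_mul]
    rw [MeasureTheory.integral_add (integrable_eval_mul_exp_neg_sq p)
      (integrable_eval_mul_exp_neg_sq q), mul_add]
  map_smul' a p := by
    simp only [eval_smul, smul_eq_mul, mul_assoc, RingHom.id_apply]
    rw [MeasureTheory.integral_const_mul]; ring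

theorem gaussianMean_C_mul (a : ℝ) (p : ℝ[X]) :
    gaussianMean (C a * p) = a * gaussianMean p := by
  rw [← smul_eq_C_mul, map_smul, smul_eq_mul]

theorem gaussianMean_one : gaussianMean 1 = 1 := by
  have h := integral_gaussian 1
  simp only [neg_mul, one_mul, div_one] at h
  have : Real.sqrt Real.pi ≠ 0 := (Real.sqrt_pos.2 Real.pi_pos).ne'
  change (Real.sqrt Real.pi)⁻¹ * ∫ x : ℝ, (1 : ℝ[X]).eval x * Real.exp (-x ^ 2) = 1
  simp only [eval_one, one_mul, h]
  exact inv_mul_cancel₀ this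

theorem gaussianMean_nonneg (p : ℝ[X]) (hp : ∀ x, 0 ≤ p.eval x) : 0 ≤ gaussianMean p :=
  mul_nonneg (by positivity)
    (MeasureTheory.integral_nonneg fun x => mul_nonneg (hp x) (Real.exp_pos _).le)

/-- Integration by parts against `exp (-x²)`. -/
theorem gaussianMean_derivative (p : ℝ[X]) :
    gaussianMean (derivative p) = gaussianMean (2 * X * p) := by
  rw [← sub_eq_zero, ← map_sub]
  change (Real.sqrt Real.pi)⁻¹ *
    ∫ x : ℝ, (derivative p - 2 * X * p).eval x * Real.exp (-x ^ 2) = 0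
  rw [MeasureTheory.integral_eq_zero_of_hasDerivAt_of_integrable
    (f := fun x => p.eval x * Real.exp (-x ^ 2)), mul_zero]
  · intro x
    have h1 : HasDerivAt (fun y : ℝ => Real.exp (-y ^ 2)) (Real.exp (-x ^ 2) * (-(2 * x))) x := by
      have := ((hasDerivAt_pow 2 x).neg).exp
      simpa using this
    refine ((p.hasDerivAt x).mul h1).congr_deriv ?_
    simp only [eval_sub, eval_mul, eval_X, eval_ofNat]
    ring
  · exact integrable_eval_mul_exp_neg_sq _
  · exact integrable_eval_mul_exp_neg_sq _

/-- Rodrigues' formula in integrated form: pairing with `H_n` takes the `n`-th derivative. -/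
theorem gaussianMean_hermiteH_mul (n : ℕ) (p : ℝ[X]) :
    gaussianMean (hermiteH n * p) = gaussianMean (derivative^[n] p) := by
  induction n generalizing p with
  | zero => simp [hermiteH]
  | succ n ih =>
    have h : hermiteH (n + 1) * p = 2 * X * (hermiteH n * p) - derivative (hermiteH n * p)
        + hermiteH n * derivative p := by
      have : hermiteH (n + 1) = 2 * X * hermiteH n - derivative (hermiteH n) := rfl
      rw [this, derivative_mul]; ring
    rw [h, map_add, map_sub, gaussianMean_derivative, sub_self, zero_add, ih,
      Function.iterate_succ_apply]

theorem gaussianMean_X_pow_add_two (k : ℕ) :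
    gaussianMean (X ^ (k + 2)) = (k + 1) / 2 * gaussianMean (X ^ k) := by
  have h := gaussianMean_derivative (X ^ (k + 1))
  rw [derivative_X_pow, show 2 * X * X ^ (k + 1) = C (2 : ℝ) * X ^ (k + 2) by
    rw [show (C (2 : ℝ) : ℝ[X]) = 2 from rfl]; ring, gaussianMean_C_mul, gaussianMean_C_mul] at h
  push_cast at h
  linarith

theorem gaussianMean_X : gaussianMean X = 0 := by
  have h := gaussianMean_derivative 1
  rw [mul_one, derivative_one, map_zero, show (2 : ℝ[X]) = C 2 from rfl, gaussianMean_C_mul] at h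
  linarith

theorem gaussianMean_X_pow_odd (m : ℕ) : gaussianMean (X ^ (2 * m + 1)) = 0 := by
  induction m with
  | zero => simpa using gaussianMean_X
  | succ m ih => rw [show 2 * (m + 1) + 1 = 2 * m + 1 + 2 by ring, gaussianMean_X_pow_add_two, ih,
      mul_zero]

theorem gaussianMean_X_pow_even (m : ℕ) :
    gaussianMean (X ^ (2 * m)) = (2 * m).factorial / (4 ^ m * m.factorial) := by
  induction m with
  | zero => simp [gaussianMean_one]
  | succ m ih =>
    rw [show 2 * (m + 1) = 2 * m + 2 by ring, gaussianMean_X_pow_add_two, ih,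
      Nat.factorial_succ, Nat.factorial_succ, Nat.factorial_succ]
    have : (m.factorial : ℝ) ≠ 0 := by positivity
    push_cast
    field_simp
    ring

theorem gaussianMean_X_pow_nonneg (k : ℕ) : 0 ≤ gaussianMean (X ^ k) := by
  rcases Nat.even_or_odd' k with ⟨m, rfl | rfl⟩
  · rw [gaussianMean_X_pow_even]; positivity
  · rw [gaussianMean_X_pow_odd]

theorem gaussianMean_hermiteH {n : ℕ} (hn : n ≠ 0) : gaussianMean (hermiteH n) = 0 := by
  rw [← mul_one (hermiteH n), gaussianMean_hermiteH_mul, iterate_derivative_one (by omega),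
    map_zero]

theorem gaussianMean_hermiteH_mul_self (n : ℕ) :
    gaussianMean (hermiteH n * hermiteH n) = 2 ^ n * n.factorial := by
  have h := iterate_derivative_hermiteH n 0
  rw [zero_add] at h
  rw [gaussianMean_hermiteH_mul, h, gaussianMean_C_mul, Nat.descFactorial_self]
  simp [hermiteH, gaussianMean_one]

theorem gaussianMean_hermiteH_mul_hermiteH {j k : ℕ} (h : k < j) :
    gaussianMean (hermiteH j * hermiteH k) = 0 := by
  rw [gaussianMean_hermiteH_mul, iterate_derivative_eq_zero (by rwa [hermiteH_natDegree]),
    map_zero]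

theorem gaussianMean_X_pow_mul_hermiteH_mul_nonneg (p j k : ℕ) :
    0 ≤ gaussianMean (X ^ p * (hermiteH j * hermiteH k)) := by
  induction p generalizing j with
  | zero =>
    rw [pow_zero, one_mul]
    rcases lt_trichotomy j k with h | rfl | h
    · rw [mul_comm, gaussianMean_hermiteH_mul_hermiteH h]
    · rw [gaussianMean_hermiteH_mul_self]; positivity
    · rw [gaussianMean_hermiteH_mul_hermiteH h]
  | succ p ih =>
    have : X ^ (p + 1) * (hermiteH j * hermiteH k) =
        C (1 / 2 : ℝ) * (X ^ p * (hermiteH (j + 1) * hermiteH k)) +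
        C (j : ℝ) * (X ^ p * (hermiteH (j - 1) * hermiteH k)) := by
      rw [pow_succ, show X ^ p * X * (hermiteH j * hermiteH k) =
        X ^ p * hermiteH k * (X * hermiteH j) by ring, X_mul_hermiteH]
      ring
    rw [this, map_add, gaussianMean_C_mul, gaussianMean_C_mul]
    have h1 := ih (j + 1)
    have h2 := ih (j - 1)
    positivity

theorem gaussianMean_X_pow_mul_hermiteH (a n : ℕ) :
    gaussianMean (X ^ a * hermiteH n) = a.descFactorial n * gaussianMean (X ^ (a - n)) := by
  rw [mul_comm, gaussianMean_hermiteH_mul, iterate_derivative_X_pow_eq_natCast_mul,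
    ← C_eq_natCast, gaussianMean_C_mul]

/-! ### Gauss–Hermite quadrature -/

theorem IsHermiteZeros.injective {N : ℕ} {t : Fin N → ℝ} (ht : IsHermiteZeros N t) :
    Function.Injective t := ht.1.injective

theorem IsHermiteZeros.eval_eq_zero {N : ℕ} {t : Fin N → ℝ} (ht : IsHermiteZeros N t)
    (j : Fin N) : (hermiteH N).eval (t j) = 0 := (ht.2 _).2 ⟨j, rfl⟩

/-- The zeros of a Hermite polynomial are symmetric about the origin. -/
theorem IsHermiteZeros.apply_rev {N : ℕ} {t : Fin N → ℝ} (ht : IsHermiteZeros N t)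
    (j : Fin N) : t j.rev = -t j := by
  have h1 : StrictMono fun j => -t j := fun a b hab => neg_lt_neg (ht.1 hab)
  have h2 : StrictMono fun j : Fin N => t j.rev := fun a b hab => ht.1 (Fin.rev_lt_rev.2 hab)
  refine congrFun ((h2.range_inj h1).1 ?_) j
  have h3 : ∀ x, (∃ j, t j = x) ↔ ∃ j, t j = -x := fun x => by
    rw [← ht.2, ← ht.2, eval_neg_hermiteH]
    simp
  ext x
  simp only [Set.mem_range]
  constructor
  · rintro ⟨k, rfl⟩
    obtain ⟨l, hl⟩ := (h3 _).1 ⟨k.rev, rfl⟩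
    exact ⟨l, by rw [hl, neg_neg]⟩
  · rintro ⟨k, rfl⟩
    obtain ⟨l, hl⟩ := (h3 _).1 ⟨k, rfl⟩
    exact ⟨l.rev, by rw [Fin.rev_rev, hl]⟩

/-- The weights of the interpolatory quadrature rule with nodes `t` for the Gaussian mean. -/
noncomputable def quadWeight {N : ℕ} (t : Fin N → ℝ) (j : Fin N) : ℝ :=
  gaussianMean (Lagrange.basis Finset.univ t j)

/-- The interpolatory quadrature rule with nodes `t` for the Gaussian mean. -/
noncomputable def quadSum {N : ℕ} (t : Fin N → ℝ) : ℝ[X] →ₗ[ℝ] ℝ where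
  toFun p := ∑ j, quadWeight t j * p.eval (t j)
  map_add' p q := by simp [mul_add, Finset.sum_add_distrib]
  map_smul' a p := by
    simp only [eval_smul, smul_eq_mul, RingHom.id_apply, Finset.mul_sum]
    exact Finset.sum_congr rfl fun _ _ => by ring

theorem quadSum_apply {N : ℕ} (t : Fin N → ℝ) (p : ℝ[X]) :
    quadSum t p = ∑ j, quadWeight t j * p.eval (t j) := rfl

/-- The error functional of the quadrature rule `quadSum`. -/
noncomputable def quadError {N : ℕ} (t : Fin N → ℝ) : ℝ[X] →ₗ[ℝ] ℝ :=
  gaussianMean - quadSum t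

theorem quadError_apply {N : ℕ} (t : Fin N → ℝ) (p : ℝ[X]) :
    quadError t p = gaussianMean p - quadSum t p := rfl

theorem quadError_C_mul {N : ℕ} (t : Fin N → ℝ) (a : ℝ) (p : ℝ[X]) :
    quadError t (C a * p) = a * quadError t p := by
  rw [← smul_eq_C_mul, map_smul, smul_eq_mul]

section

variable {N : ℕ} {t : Fin N → ℝ}

theorem quadError_eq_zero_of_degree_lt (ht : Function.Injective t) {p : ℝ[X]}
    (hp : p.degree < N) : quadError t p = 0 := by
  have h := Lagrange.eq_interpolate (s := Finset.univ) (v := t) (f := p) ht.injOn (by simpa using hp)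
  rw [Lagrange.interpolate_apply] at h
  rw [quadError_apply, sub_eq_zero]
  conv_lhs => rw [h]
  rw [map_sum, quadSum_apply]
  refine Finset.sum_congr rfl fun j _ => ?_
  rw [gaussianMean_C_mul, mul_comm]; rfl

/-- A nonnegative upper bound for the quadrature error of `x ^ a * H_j`. The error obeys the
three-term recursion of the Hermite polynomials below level `N`, with source term
`gaussianMean (x ^ a * H_N)` at level `N`, where the quadrature sum vanishes; the bound obeys the
same recursion with a larger source. -/
theorem quadError_X_pow_mul_hermiteH_bounds (ht : IsHermiteZeros N t) (a j : ℕ) (hj : j ≤ N) :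
    0 ≤ quadError t (X ^ a * hermiteH j) ∧
    quadError t (X ^ a * hermiteH j) ≤ (1 / (2 ^ N * N.factorial)) *
      ∑ x ∈ Finset.HasAntidiagonal.antidiagonal a, gaussianMean (X ^ x.1 * (hermiteH j * hermiteH N)) *
        gaussianMean (X ^ x.2 * hermiteH N) := by
  have hnn : ∀ b, 0 ≤ gaussianMean (X ^ b * hermiteH N) := fun b => by
    rw [gaussianMean_X_pow_mul_hermiteH]
    exact mul_nonneg (Nat.cast_nonneg _) (gaussianMean_X_pow_nonneg _)
  have top : ∀ a, 0 ≤ quadError t (X ^ a * hermiteH N) ∧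
      quadError t (X ^ a * hermiteH N) ≤ (1 / (2 ^ N * N.factorial)) *
      ∑ x ∈ Finset.HasAntidiagonal.antidiagonal a, gaussianMean (X ^ x.1 * (hermiteH N * hermiteH N)) *
        gaussianMean (X ^ x.2 * hermiteH N) := by
    intro a
    have hE : quadError t (X ^ a * hermiteH N) = gaussianMean (X ^ a * hermiteH N) := by
      rw [quadError_apply, quadSum_apply]
      simp [ht.eval_eq_zero]
    rw [hE]
    refine ⟨hnn a, ?_⟩
    have h1 : gaussianMean (X ^ 0 * (hermiteH N * hermiteH N)) *
        gaussianMean (X ^ a * hermiteH N) ≤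
        ∑ x ∈ Finset.HasAntidiagonal.antidiagonal a, gaussianMean (X ^ x.1 * (hermiteH N * hermiteH N)) *
        gaussianMean (X ^ x.2 * hermiteH N) :=
      Finset.single_le_sum (f := fun x : ℕ × ℕ =>
        gaussianMean (X ^ x.1 * (hermiteH N * hermiteH N)) * gaussianMean (X ^ x.2 * hermiteH N))
        (fun x _ => mul_nonneg (gaussianMean_X_pow_mul_hermiteH_mul_nonneg _ _ _) (hnn _))
        (a := (0, a)) (by simp)
    rw [pow_zero, one_mul, gaussianMean_hermiteH_mul_self] at h1
    rw [one_div_mul_eq_div, le_div_iff₀ (by positivity)]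
    linarith
  induction a generalizing j with
  | zero =>
    rcases hj.lt_or_eq with hj | rfl
    · have : quadError t (X ^ 0 * hermiteH j) = 0 := by
        apply quadError_eq_zero_of_degree_lt ht.injective
        rw [pow_zero, one_mul, degree_eq_natDegree (hermiteH_ne_zero j), hermiteH_natDegree]
        exact_mod_cast hj
      rw [this]
      refine ⟨le_rfl, ?_⟩
      refine mul_nonneg (by positivity) (Finset.sum_nonneg fun x _ => mul_nonneg
        (gaussianMean_X_pow_mul_hermiteH_mul_nonneg _ _ _) (hnn _))
    · exact top 0
  | succ a ih =>
    rcases hj.lt_or_eq with hj | rfl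
    · have key : ∀ b (q : ℝ[X]), X ^ (b + 1) * (hermiteH j * q) =
          C (1 / 2 : ℝ) * (X ^ b * (hermiteH (j + 1) * q)) +
          C (j : ℝ) * (X ^ b * (hermiteH (j - 1) * q)) := by
        intro b q
        rw [pow_succ, show X ^ b * X * (hermiteH j * q) = X ^ b * q * (X * hermiteH j) by ring,
          X_mul_hermiteH]
        ring
      have k1 := key a 1
      simp only [mul_one] at k1
      rw [k1, map_add, quadError_C_mul, quadError_C_mul, Finset.Nat.sum_antidiagonal_succ]
      obtain ⟨l1, u1⟩ := ih (j + 1) hj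
      obtain ⟨l2, u2⟩ := ih (j - 1) (by omega)
      refine ⟨by positivity, ?_⟩
      have hz : gaussianMean (X ^ 0 * (hermiteH j * hermiteH N)) = 0 := by
        rw [pow_zero, one_mul, mul_comm, gaussianMean_hermiteH_mul_hermiteH hj]
      simp only [hz, zero_mul, zero_add, key, map_add, gaussianMean_C_mul]
      have hs : ∀ S : Finset (ℕ × ℕ), ∑ x ∈ S,
          (1 / 2 * gaussianMean (X ^ x.1 * (hermiteH (j + 1) * hermiteH N)) +
            j * gaussianMean (X ^ x.1 * (hermiteH (j - 1) * hermiteH N))) *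
              gaussianMean (X ^ x.2 * hermiteH N) =
          1 / 2 * (∑ x ∈ S, gaussianMean (X ^ x.1 * (hermiteH (j + 1) * hermiteH N)) *
            gaussianMean (X ^ x.2 * hermiteH N)) +
          j * (∑ x ∈ S, gaussianMean (X ^ x.1 * (hermiteH (j - 1) * hermiteH N)) *
            gaussianMean (X ^ x.2 * hermiteH N)) := by
        intro S
        rw [Finset.mul_sum, Finset.mul_sum, ← Finset.sum_add_distrib]
        exact Finset.sum_congr rfl fun _ _ => by ring
      rw [hs, mul_add, mul_left_comm _ (1 / 2 : ℝ), mul_left_comm _ (j : ℝ)]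
      exact add_le_add (mul_le_mul_of_nonneg_left u1 (by norm_num))
        (mul_le_mul_of_nonneg_left u2 (by positivity))
    · exact top _

theorem quadError_X_pow_nonneg (ht : IsHermiteZeros N t) (a : ℕ) :
    0 ≤ quadError t (X ^ a) := by
  simpa [hermiteH] using (quadError_X_pow_mul_hermiteH_bounds ht a 0 (Nat.zero_le _)).1

theorem quadError_X_pow_le (ht : IsHermiteZeros N t) (a : ℕ) :
    quadError t (X ^ a) ≤ (1 / (2 ^ N * N.factorial)) *
      ∑ x ∈ Finset.HasAntidiagonal.antidiagonal a, gaussianMean (X ^ x.1 * hermiteH N) *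
        gaussianMean (X ^ x.2 * hermiteH N) := by
  simpa [hermiteH] using (quadError_X_pow_mul_hermiteH_bounds ht a 0 (Nat.zero_le _)).2

/-- The quadrature rule at the Hermite zeros is exact up to degree `2 N - 1`. -/
theorem quadError_eq_zero (ht : IsHermiteZeros N t) {p : ℝ[X]} (hp : p.natDegree < 2 * N) :
    quadError t p = 0 := by
  have hX : ∀ a < 2 * N, quadError t (X ^ a) = 0 := by
    intro a ha
    refine le_antisymm ((quadError_X_pow_le ht a).trans_eq ?_) (quadError_X_pow_nonneg ht a)
    rw [Finset.sum_eq_zero, mul_zero]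
    rintro ⟨x, y⟩ hxy
    rw [Finset.HasAntidiagonal.mem_antidiagonal] at hxy
    simp only at hxy ⊢
    simp only [gaussianMean_X_pow_mul_hermiteH]
    rcases lt_or_ge x N with h | h
    · rw [Nat.descFactorial_eq_zero_iff_lt.2 h]; simp
    · rw [Nat.descFactorial_eq_zero_iff_lt.2 (show y < N by omega)]; simp
  rw [as_sum_range' p (2 * N) hp, map_sum]
  refine Finset.sum_eq_zero fun a ha => ?_
  rw [← C_mul_X_pow_eq_monomial, quadError_C_mul, hX a (Finset.mem_range.1 ha), mul_zero]

theorem quadWeight_nonneg (ht : IsHermiteZeros N t) (j : Fin N) : 0 ≤ quadWeight t j := by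
  set p := Lagrange.basis Finset.univ t j
  have hdeg : (p * p).natDegree < 2 * N := by
    have h1 : p.natDegree = N - 1 := by
      have h := Lagrange.natDegree_basis (s := Finset.univ) (v := t) ht.injective.injOn
        (Finset.mem_univ j)
      simpa using h
    have h2 := natDegree_mul_le (p := p) (q := p)
    have := j.pos
    omega
  have h := quadError_eq_zero ht hdeg
  have hs : quadSum t (p * p) = quadWeight t j := by
    rw [quadSum_apply, Finset.sum_eq_single j]
    · rw [eval_mul, Lagrange.eval_basis_self ht.injective.injOn (Finset.mem_univ j)]; ring
    · intro k _ hk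
      rw [eval_mul, Lagrange.eval_basis_of_ne hk.symm (Finset.mem_univ k)]; ring
    · simp
  rw [quadError_apply, hs, sub_eq_zero] at h
  rw [← h]
  exact gaussianMean_nonneg _ fun x => by rw [eval_mul]; exact mul_self_nonneg _

theorem sum_quadWeight (ht : IsHermiteZeros N t) (hN : 1 ≤ N) : ∑ j, quadWeight t j = 1 := by
  have h := quadError_eq_zero ht (p := 1) (by rw [natDegree_one]; omega)
  rw [quadError_apply, gaussianMean_one, quadSum_apply] at h
  simp only [eval_one, mul_one] at h
  linarith

theorem quadSum_hermiteH_eq_zero (ht : IsHermiteZeros N t) {n : ℕ} (h0 : n ≠ 0)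
    (hn : n < 2 * N) : quadSum t (hermiteH n) = 0 := by
  have h := quadError_eq_zero ht (p := hermiteH n) (by rwa [hermiteH_natDegree])
  rw [quadError_apply, gaussianMean_hermiteH h0] at h
  linarith

theorem quadSum_X_pow_le (ht : IsHermiteZeros N t) (a : ℕ) :
    quadSum t (X ^ a) ≤ gaussianMean (X ^ a) := by
  have := quadError_X_pow_nonneg ht a
  rw [quadError_apply] at this
  linarith

end

/-! ### Positivity of the quadrature error -/

theorem sum_antidiagonal_choose_mul_choose (n a b : ℕ) :
    ∑ x ∈ Finset.HasAntidiagonal.antidiagonal n, x.1.choose a * x.2.choose b =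
      (n + 1).choose (a + b + 1) := by
  induction n generalizing a with
  | zero =>
    cases a <;> cases b <;> simp [Nat.choose_eq_zero_of_lt]
  | succ n ih =>
    rw [Finset.Nat.sum_antidiagonal_succ]
    cases a with
    | zero =>
      have h := ih 0
      simp only [Nat.choose_zero_right, one_mul, zero_add] at h ⊢
      rw [h, Nat.choose_succ_succ (n + 1) b]
    | succ a =>
      simp only [Nat.choose_zero_succ, zero_mul, zero_add, Nat.choose_succ_succ _ a, add_mul,
        Finset.sum_add_distrib]
      rw [ih a, ih (a + 1), show a + 1 + b + 1 = (a + b + 1) + 1 by ring,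
        Nat.choose_succ_succ (n + 1)]

theorem gaussianMean_X_pow_le (m : ℕ) : gaussianMean (X ^ (2 * m)) ≤ m.factorial := by
  rw [gaussianMean_X_pow_even, div_le_iff₀ (by positivity)]
  have h := Nat.centralBinom_le_four_pow m
  have h2 : m.centralBinom * m.factorial * m.factorial = (2 * m).factorial := by
    rw [Nat.centralBinom, two_mul, Nat.add_choose_mul_factorial_mul_factorial]
  rw [← h2]
  push_cast
  have h3 : (m.centralBinom : ℝ) ≤ 4 ^ m := by exact_mod_cast h
  nlinarith [mul_le_mul_of_nonneg_right h3 (by positivity : (0 : ℝ) ≤ m.factorial * m.factorial)]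

theorem gaussianMean_X_pow_mul_gaussianMean_X_pow_le {a b i : ℕ} (h : a + b = 2 * i) :
    gaussianMean (X ^ a) * gaussianMean (X ^ b) ≤ i.factorial := by
  rcases Nat.even_or_odd' a with ⟨m, rfl | rfl⟩
  · obtain ⟨k, rfl⟩ : ∃ k, b = 2 * k := ⟨i - m, by omega⟩
    have hi : i = m + k := by omega
    calc gaussianMean (X ^ (2 * m)) * gaussianMean (X ^ (2 * k))
        ≤ m.factorial * k.factorial := mul_le_mul (gaussianMean_X_pow_le m)
          (gaussianMean_X_pow_le k) (gaussianMean_X_pow_nonneg _) (Nat.cast_nonneg _)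
      _ ≤ i.factorial := by
        rw [hi]
        exact_mod_cast Nat.le_of_dvd (Nat.factorial_pos _)
          (Nat.factorial_mul_factorial_dvd_factorial_add m k)
  · rw [gaussianMean_X_pow_odd, zero_mul]
    positivity

section

variable {N : ℕ} {t : Fin N → ℝ}

theorem quadError_X_pow_add_le (ht : IsHermiteZeros N t) (i : ℕ) :
    quadError t (X ^ (2 * N + 2 * i)) ≤
      N.factorial / 2 ^ N * (i.factorial * (2 * N + 2 * i + 1).choose (2 * N + 1)) := by
  refine (quadError_X_pow_le ht _).trans ?_
  have h : ∑ x ∈ Finset.HasAntidiagonal.antidiagonal (2 * N + 2 * i),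
      gaussianMean (X ^ x.1 * hermiteH N) * gaussianMean (X ^ x.2 * hermiteH N) ≤
      ∑ x ∈ Finset.HasAntidiagonal.antidiagonal (2 * N + 2 * i),
        ((N.factorial : ℝ) ^ 2 * i.factorial) * ((x.1.choose N * x.2.choose N : ℕ) : ℝ) := by
    refine Finset.sum_le_sum fun x hx => ?_
    rw [Finset.HasAntidiagonal.mem_antidiagonal] at hx
    rw [gaussianMean_X_pow_mul_hermiteH, gaussianMean_X_pow_mul_hermiteH]
    by_cases h1 : N ≤ x.1 ∧ N ≤ x.2
    · have := gaussianMean_X_pow_mul_gaussianMean_X_pow_le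
        (show (x.1 - N) + (x.2 - N) = 2 * i by omega)
      rw [Nat.descFactorial_eq_factorial_mul_choose, Nat.descFactorial_eq_factorial_mul_choose]
      push_cast
      have h2 := mul_le_mul_of_nonneg_left this
        (by positivity : (0 : ℝ) ≤ N.factorial ^ 2 * (x.1.choose N * x.2.choose N))
      linarith
    · have : x.1.descFactorial N = 0 ∨ x.2.descFactorial N = 0 := by
        rw [Nat.descFactorial_eq_zero_iff_lt, Nat.descFactorial_eq_zero_iff_lt]; omega
      have h0 : (x.1.descFactorial N * gaussianMean (X ^ (x.1 - N))) *
          (x.2.descFactorial N * gaussianMean (X ^ (x.2 - N))) = (0 : ℝ) := by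
        rcases this with h | h <;> rw [h] <;> simp
      rw [h0]; positivity
  refine (mul_le_mul_of_nonneg_left h (by positivity)).trans_eq ?_
  rw [← Finset.mul_sum, ← Nat.cast_sum, sum_antidiagonal_choose_mul_choose,
    show N + N + 1 = 2 * N + 1 by ring]
  have : (N.factorial : ℝ) ≠ 0 := by positivity
  field_simp

/-- The quadrature error is a positive functional of the `2 N`-th derivative. -/
theorem quadError_nonneg (ht : IsHermiteZeros N t) (hN : 1 ≤ N) (P : ℝ[X])
    (hP : ∀ x, 0 ≤ (derivative^[2 * N] P).eval x) : 0 ≤ quadError t P := by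
  set V : ℝ[X] := ∏ j, (X - C (t j)) with hV
  have hVm : V.Monic := monic_prod_of_monic _ _ fun j _ => monic_X_sub_C _
  have hVd : V.natDegree = N := by
    rw [hV, natDegree_prod_of_monic _ _ fun j _ => monic_X_sub_C _]; simp
  have hVz : ∀ j, V.eval (t j) = 0 := fun j => by
    rw [hV, eval_prod]
    exact Finset.prod_eq_zero (Finset.mem_univ j) (by simp)
  have hVr : V.roots.card = N := by
    have h0 : ∏ j, (X - C (t j)) ≠ 0 := hVm.ne_zero
    rw [hV, roots_prod _ _ h0]
    simp
  set W : ℝ[X] := V * V with hW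
  have hWm : W.Monic := hVm.mul hVm
  have hWd : W.natDegree = 2 * N := by rw [hW, hVm.natDegree_mul hVm, hVd, two_mul]
  set R := P %ₘ W
  set S := P /ₘ W
  have hPd : R + W * S = P := modByMonic_add_div P W
  have hRd : R.natDegree < 2 * N := by
    have := natDegree_modByMonic_lt P hWm (by
      intro h; rw [h, natDegree_one] at hWd; omega)
    rwa [hWd] at this
  have hWit : derivative^[2 * N] W = C ((2 * N).factorial : ℝ) := by
    have h1 := natDegree_iterate_derivative W (2 * N)
    rw [hWd, Nat.sub_self] at h1
    rw [eq_C_of_natDegree_le_zero h1, coeff_iterate_derivative, zero_add, Nat.descFactorial_self,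
      ← hWd, hWm.coeff_natDegree]
    simp
  -- Rolle: `P - R - S(x) W` has at least `2 N + 1` zeros, counted with multiplicity.
  have hS : ∀ x, 0 ≤ S.eval x := by
    intro x
    set F : ℝ[X] := W * (S - C (S.eval x)) with hF
    have hFder : derivative^[2 * N] F =
        derivative^[2 * N] P - C (S.eval x) * C ((2 * N).factorial : ℝ) := by
      have : F = P - R - C (S.eval x) * W := by rw [← hPd, hF]; ring
      rw [this, iterate_derivative_sub, iterate_derivative_sub, iterate_derivative_C_mul, hWit,
        iterate_derivative_eq_zero hRd, sub_zero]
    obtain ⟨ξ, hξ⟩ : ∃ ξ, (derivative^[2 * N] F).eval ξ = 0 := by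
      by_cases hF0 : F = 0
      · exact ⟨0, by rw [hF0, iterate_map_zero, eval_zero]⟩
      have hcard : 2 * N + 1 ≤ F.roots.card := by
        obtain ⟨T, hT⟩ : X - C x ∣ S - C (S.eval x) := X_sub_C_dvd_sub_C_eval
        have hF' : F = W * ((X - C x) * T) := by rw [hF, hT]
        rw [hF'] at hF0 ⊢
        rw [roots_mul hF0, roots_mul (right_ne_zero_of_mul hF0), hW,
          roots_mul hWm.ne_zero, roots_X_sub_C]
        simp only [Multiset.card_add, hVr, Multiset.card_singleton]
        omega
      have hit : ∀ k, F.roots.card ≤ (derivative^[k] F).roots.card + k := by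
        intro k
        induction k with
        | zero => simp
        | succ k ih =>
          have := card_roots_le_derivative (derivative^[k] F)
          rw [Function.iterate_succ_apply']
          omega
      have h1 := hit (2 * N)
      obtain ⟨ξ, hξ⟩ := Multiset.card_pos_iff_exists_mem.1
        (show 0 < (derivative^[2 * N] F).roots.card by omega)
      exact ⟨ξ, isRoot_of_mem_roots hξ⟩
    rw [hFder, eval_sub, eval_mul, eval_C, eval_C] at hξ
    have h2 := hP ξ
    have h3 : (0 : ℝ) < (2 * N).factorial := by positivity
    have h4 : 0 ≤ S.eval x * (2 * N).factorial := by linarith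
    exact nonneg_of_mul_nonneg_left h4 h3
  rw [← hPd, map_add, quadError_eq_zero ht hRd, zero_add, quadError_apply, quadSum_apply]
  have h0 : ∑ j, quadWeight t j * (W * S).eval (t j) = 0 :=
    Finset.sum_eq_zero fun j _ => by simp [hW, hVz]
  rw [h0, sub_zero]
  refine gaussianMean_nonneg _ fun x => ?_
  rw [eval_mul, hW, eval_mul]
  exact mul_nonneg (mul_self_nonneg _) (hS x)

end

/-- The Taylor polynomial of `exp (x² / 2)` with `I` nonzero terms. -/
noncomputable def expTrunc (I : ℕ) : ℝ[X] :=
  ∑ i ∈ Finset.range I, C (1 / (2 ^ i * i.factorial) : ℝ) * X ^ (2 * i)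

theorem eval_expTrunc (I : ℕ) (x : ℝ) :
    (expTrunc I).eval x = ∑ i ∈ Finset.range I, (x ^ 2 / 2) ^ i / i.factorial := by
  simp only [expTrunc, eval_finsetSum, eval_mul, eval_C, eval_pow, eval_X]
  refine Finset.sum_congr rfl fun i _ => ?_
  rw [div_pow, pow_mul]
  field_simp

/-- A polynomial dominated by `exp (x² / 2)` is dominated by its Taylor polynomials. -/
theorem exists_abs_eval_le_expTrunc (p : ℝ[X]) {A : ℝ} (hA : 0 < A)
    (hp : ∀ x, |p.eval x| ≤ A * Real.exp (x ^ 2 / 2)) :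
    ∃ I, ∀ x, |p.eval x| ≤ 2 * A * (expTrunc I).eval x := by
  set d := p.natDegree
  set M : ℝ := ∑ i ∈ Finset.range (d + 1), |p.coeff i|
  have hM : 0 ≤ M := Finset.sum_nonneg fun _ _ => abs_nonneg _
  set D : ℝ := ((d + 1).factorial : ℝ)
  have hD : 0 < D := by positivity
  set U : ℝ := max 2 (M * D / (2 * A))
  obtain ⟨I, hI, hId⟩ : ∃ I, Real.exp U - 1 / 2 ≤
      ∑ i ∈ Finset.range I, U ^ i / i.factorial ∧ d + 2 ≤ I := by
    have h := (NormedSpace.expSeries_div_hasSum_exp U).tendsto_sum_nat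
    rw [← Real.exp_eq_exp_ℝ] at h
    have h1 := h.eventually (lt_mem_nhds (show Real.exp U - 1 / 2 < Real.exp U by linarith))
    obtain ⟨I, h2, h3⟩ := (h1.and (Filter.eventually_ge_atTop (d + 2))).exists
    exact ⟨I, h2.le, h3⟩
  refine ⟨I, fun x => ?_⟩
  rw [eval_expTrunc]
  set u := x ^ 2 / 2 with hu
  have hu0 : 0 ≤ u := by positivity
  rcases le_or_gt u U with h | h
  · -- On a compact set the tail of the exponential series is at most `1 / 2`.
    have hsum : HasSum (fun i : ℕ => U ^ i / i.factorial - u ^ i / i.factorial)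
        (Real.exp U - Real.exp u) := by
      rw [Real.exp_eq_exp_ℝ]
      exact (NormedSpace.expSeries_div_hasSum_exp U).sub (NormedSpace.expSeries_div_hasSum_exp u)
    have hle := sum_le_hasSum (Finset.range I) (fun i _ => sub_nonneg.2
      (div_le_div_of_nonneg_right (pow_le_pow_left₀ hu0 h i) (Nat.cast_nonneg _))) hsum
    rw [Finset.sum_sub_distrib] at hle
    have h1 : (1 : ℝ) ≤ Real.exp u := Real.one_le_exp hu0
    have h2 : Real.exp u ≤ 2 * ∑ i ∈ Finset.range I, u ^ i / i.factorial := by linarith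
    calc |p.eval x| ≤ A * Real.exp u := hp x
      _ ≤ A * (2 * ∑ i ∈ Finset.range I, u ^ i / i.factorial) :=
        mul_le_mul_of_nonneg_left h2 hA.le
      _ = _ := by ring
  · have hu1 : 2 ≤ u := (le_max_left _ _).trans h.le
    have hx2 : 2 ≤ |x| := by
      have : 4 ≤ |x| ^ 2 := by rw [sq_abs]; linarith
      nlinarith [abs_nonneg x]
    have hx1 : 1 ≤ |x| := by linarith
    have h1 : |p.eval x| ≤ M * |x| ^ d := by
      rw [eval_eq_sum_range, Finset.sum_mul]
      refine (Finset.abs_sum_le_sum_abs _ _).trans (Finset.sum_le_sum fun i hi => ?_)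
      rw [abs_mul, abs_pow]
      exact mul_le_mul_of_nonneg_left
        (pow_le_pow_right₀ hx1 (Nat.lt_succ_iff.1 (Finset.mem_range.1 hi))) (abs_nonneg _)
    have h2 : |x| ^ d ≤ u ^ d := by
      refine pow_le_pow_left₀ (abs_nonneg _) ?_ _
      have : u = |x| ^ 2 / 2 := by rw [sq_abs]
      nlinarith
    have h3 : u ^ (d + 1) / D ≤ ∑ i ∈ Finset.range I, u ^ i / i.factorial :=
      Finset.single_le_sum (f := fun i : ℕ => u ^ i / i.factorial) (fun i _ => by positivity)
        (Finset.mem_range.2 (by omega))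
    have h4 : M * D ≤ 2 * A * u := by
      have := (le_max_right 2 (M * D / (2 * A))).trans h.le
      rw [div_le_iff₀ (by positivity)] at this
      linarith
    calc |p.eval x| ≤ M * u ^ d := h1.trans (mul_le_mul_of_nonneg_left h2 hM)
      _ ≤ 2 * A * (u ^ (d + 1) / D) := by
        rw [pow_succ, ← mul_div_assoc, le_div_iff₀ hD]
        nlinarith [mul_le_mul_of_nonneg_right h4 (by positivity : 0 ≤ u ^ d)]
      _ ≤ _ := mul_le_mul_of_nonneg_left h3 (by positivity)

/-! ### Quadrature sums of Hermite polynomials -/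

/-- A `2 N`-fold antiderivative of `expTrunc I`. -/
noncomputable def expTruncPrimitive (N I : ℕ) : ℝ[X] :=
  ∑ i ∈ Finset.range I, C ((2 * i).factorial / (2 ^ i * i.factorial * (2 * N + 2 * i).factorial) : ℝ)
    * X ^ (2 * N + 2 * i)

theorem iterate_derivative_expTruncPrimitive (N I : ℕ) :
    derivative^[2 * N] (expTruncPrimitive N I) = expTrunc I := by
  rw [expTruncPrimitive, expTrunc, iterate_derivative_sum]
  refine Finset.sum_congr rfl fun i _ => ?_
  rw [iterate_derivative_C_mul, iterate_derivative_X_pow_eq_natCast_mul, Nat.add_sub_cancel_left,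
    ← mul_assoc, ← C_eq_natCast, ← C_mul]
  congr 2
  have h := Nat.factorial_mul_descFactorial (show 2 * N ≤ 2 * N + 2 * i by omega)
  rw [Nat.add_sub_cancel_left] at h
  rw [← h]
  have h1 : ((2 * i).factorial : ℝ) ≠ 0 := by positivity
  have h2 : (((2 * N + 2 * i).descFactorial (2 * N) : ℕ) : ℝ) ≠ 0 := by
    rw [Nat.cast_ne_zero, Ne, Nat.descFactorial_eq_zero_iff_lt]; omega
  push_cast
  field_simp

section

variable {N : ℕ} {t : Fin N → ℝ}

/-- Uniform in the number `I` of terms; `6 = ∑ (1 + 2 i) / 2 ^ i`. -/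
theorem quadError_expTruncPrimitive_le (ht : IsHermiteZeros N t) (I : ℕ) :
    quadError t (expTruncPrimitive N I) ≤ 6 * N.factorial / (2 ^ N * (2 * N).factorial) := by
  rw [expTruncPrimitive, map_sum]
  have hsum : HasSum (fun i : ℕ => (1 / 2 : ℝ) ^ i + 2 * (i * (1 / 2 : ℝ) ^ i)) 6 := by
    have h1 := hasSum_geometric_two
    have h2 := (hasSum_coe_mul_geometric_of_norm_lt_one (r := (1 / 2 : ℝ)) (by norm_num)).mul_left 2
    convert h1.add h2 using 1
    norm_num
  have hterm : ∀ i, quadError t (C ((2 * i).factorial /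
      (2 ^ i * i.factorial * (2 * N + 2 * i).factorial) : ℝ) * X ^ (2 * N + 2 * i)) ≤
      N.factorial / (2 ^ N * (2 * N).factorial) *
        ((1 / 2 : ℝ) ^ i + 2 * (i * (1 / 2 : ℝ) ^ i)) := by
    intro i
    rw [quadError_C_mul]
    refine (mul_le_mul_of_nonneg_left (quadError_X_pow_add_le ht i) (by positivity)).trans ?_
    have h := Nat.add_choose_mul_factorial_mul_factorial (2 * i) (2 * N + 1)
    rw [show 2 * i + (2 * N + 1) = 2 * N + 2 * i + 1 by ring, Nat.factorial_succ (2 * N + 2 * i),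
      Nat.factorial_succ (2 * N)] at h
    have h' : ((2 * N + 2 * i + 1).choose (2 * N + 1) : ℝ) * (2 * i).factorial =
        (2 * N + 2 * i + 1) * (2 * N + 2 * i).factorial / ((2 * N + 1) * (2 * N).factorial) := by
      rw [eq_div_iff (by positivity)]
      exact_mod_cast h
    have e : ((2 * i).factorial / (2 ^ i * i.factorial * (2 * N + 2 * i).factorial) : ℝ) *
        (N.factorial / 2 ^ N * (i.factorial * (2 * N + 2 * i + 1).choose (2 * N + 1))) =
        N.factorial / (2 ^ N * (2 * N).factorial) * ((1 / 2 : ℝ) ^ i *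
          ((2 * N + 2 * i + 1) / (2 * N + 1))) := by
      calc _ = (N.factorial : ℝ) / (2 ^ N * 2 ^ i * (2 * N + 2 * i).factorial) *
          ((2 * N + 2 * i + 1).choose (2 * N + 1) * (2 * i).factorial) := by
            field_simp
        _ = _ := by
            rw [h', one_div, inv_pow]
            field_simp
    rw [e]
    refine mul_le_mul_of_nonneg_left ?_ (by positivity)
    have : (2 * N + 2 * i + 1 : ℝ) / (2 * N + 1) ≤ 1 + 2 * i := by
      rw [div_le_iff₀ (by positivity)]
      have : (0 : ℝ) ≤ i * N := by positivity
      nlinarith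
    have h2 := mul_le_mul_of_nonneg_left this (by positivity : (0 : ℝ) ≤ (1 / 2) ^ i)
    linarith
  calc _ ≤ ∑ i ∈ Finset.range I, N.factorial / (2 ^ N * (2 * N).factorial) *
        ((1 / 2 : ℝ) ^ i + 2 * (i * (1 / 2 : ℝ) ^ i)) := Finset.sum_le_sum fun i _ => hterm i
    _ = N.factorial / (2 ^ N * (2 * N).factorial) *
        ∑ i ∈ Finset.range I, ((1 / 2 : ℝ) ^ i + 2 * (i * (1 / 2 : ℝ) ^ i)) := by
        rw [Finset.mul_sum]
    _ ≤ N.factorial / (2 ^ N * (2 * N).factorial) * 6 := by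
        refine mul_le_mul_of_nonneg_left ?_ (by positivity)
        exact sum_le_hasSum _ (fun i _ => by positivity) hsum
    _ = _ := by ring

/-- A bound for the quadrature sums of `H_n`, `n ≥ 2 N`, which is sharp up to constants for `n`
close to `2 N`: the quadrature error is estimated through the `2 N`-th derivative. -/
theorem abs_quadSum_hermiteH_add_le (ht : IsHermiteZeros N t) (hN : 1 ≤ N) (m : ℕ) {A : ℝ}
    (hA : 0 < A) (hm : ∀ x, |(hermiteH m).eval x| ≤ A * Real.exp (x ^ 2 / 2)) :
    |quadSum t (hermiteH (m + 2 * N))| ≤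
      12 * A * (2 ^ N * N.factorial / (2 * N).factorial) *
        (m + 2 * N).descFactorial (2 * N) := by
  obtain ⟨I, hI⟩ := exists_abs_eval_le_expTrunc _ hA hm
  set κ : ℝ := 2 ^ (2 * N) * ((m + 2 * N).descFactorial (2 * N) : ℝ)
  have hκ : 0 ≤ κ := by positivity
  have hQ : quadSum t (hermiteH (m + 2 * N)) = - quadError t (hermiteH (m + 2 * N)) := by
    rw [quadError_apply, gaussianMean_hermiteH (by omega)]; ring
  set P := C (κ * (2 * A)) * expTruncPrimitive N I
  have hder : derivative^[2 * N] P = C (κ * (2 * A)) * expTrunc I := by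
    rw [iterate_derivative_C_mul, iterate_derivative_expTruncPrimitive]
  have h1 : 0 ≤ quadError t (P + hermiteH (m + 2 * N)) := by
    refine quadError_nonneg ht hN _ fun x => ?_
    rw [iterate_map_add, hder, iterate_derivative_hermiteH]
    simp only [eval_add, eval_mul, eval_C]
    have := mul_le_mul_of_nonneg_left ((neg_abs_le _).trans' (neg_le_neg (hI x))) hκ
    change 0 ≤ κ * (2 * A) * _ + κ * _
    linarith
  have h2 : 0 ≤ quadError t (P - hermiteH (m + 2 * N)) := by
    refine quadError_nonneg ht hN _ fun x => ?_
    rw [iterate_derivative_sub, hder, iterate_derivative_hermiteH]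
    simp only [eval_sub, eval_mul, eval_C]
    have := mul_le_mul_of_nonneg_left ((le_abs_self _).trans (hI x)) hκ
    change 0 ≤ κ * (2 * A) * _ - κ * _
    linarith
  rw [map_add] at h1
  rw [map_sub] at h2
  have h3 : quadError t P ≤ κ * (2 * A) * (6 * N.factorial / (2 ^ N * (2 * N).factorial)) := by
    rw [quadError_C_mul]
    exact mul_le_mul_of_nonneg_left (quadError_expTruncPrimitive_le ht I) (by positivity)
  rw [hQ, abs_neg]
  refine (abs_le.2 ⟨by linarith, by linarith⟩ : |_| ≤ quadError t P).trans (h3.trans_eq ?_)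
  simp only [κ, pow_mul']
  field_simp
  ring

/-- The quadrature rule integrates `exp (x² / 2)` to a bounded value. -/
theorem sum_quadWeight_mul_exp_le (ht : IsHermiteZeros N t) :
    ∑ j, quadWeight t j * Real.exp (t j ^ 2 / 2) ≤ 2 := by
  have h : HasSum (fun i : ℕ => ∑ j, quadWeight t j * ((t j ^ 2 / 2) ^ i / i.factorial))
      (∑ j, quadWeight t j * Real.exp (t j ^ 2 / 2)) := by
    refine hasSum_sum fun j _ => HasSum.mul_left _ ?_
    rw [Real.exp_eq_exp_ℝ]
    exact NormedSpace.expSeries_div_hasSum_exp _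
  refine hasSum_le (fun i => ?_) h hasSum_geometric_two
  have h1 := (quadSum_X_pow_le ht (2 * i)).trans (gaussianMean_X_pow_le i)
  rw [quadSum_apply] at h1
  have h2 : ∑ j, quadWeight t j * ((t j ^ 2 / 2) ^ i / i.factorial) =
      (∑ j, quadWeight t j * (X ^ (2 * i) : ℝ[X]).eval (t j)) * (1 / (2 ^ i * i.factorial)) := by
    rw [Finset.sum_mul]
    refine Finset.sum_congr rfl fun j _ => ?_
    rw [eval_pow, eval_X, div_pow, pow_mul]
    field_simp
  rw [h2]
  refine (mul_le_mul_of_nonneg_right h1 (by positivity)).trans_eq ?_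
  rw [one_div_pow]
  field_simp

theorem abs_quadSum_hermiteH_le (ht : IsHermiteZeros N t) (n : ℕ) {A : ℝ}
    (hA : 0 < A) (hn : ∀ x, |(hermiteH n).eval x| ≤ A * Real.exp (x ^ 2 / 2)) :
    |quadSum t (hermiteH n)| ≤ 2 * A := by
  rw [quadSum_apply]
  calc _ ≤ ∑ j, |quadWeight t j * (hermiteH n).eval (t j)| := Finset.abs_sum_le_sum_abs _ _
    _ ≤ ∑ j, A * (quadWeight t j * Real.exp (t j ^ 2 / 2)) := by
      refine Finset.sum_le_sum fun j _ => ?_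
      rw [abs_mul, abs_of_nonneg (quadWeight_nonneg ht j), mul_left_comm]
      exact mul_le_mul_of_nonneg_left (hn _) (quadWeight_nonneg ht j)
    _ ≤ A * 2 := by
      rw [← Finset.mul_sum]
      exact mul_le_mul_of_nonneg_left (sum_quadWeight_mul_exp_le ht) hA.le
    _ = 2 * A := mul_comm _ _

end

/-! ### Moment representation and generating functions -/

theorem integrable_exp_quadratic {b : ℝ} (hb : 0 < b) (a c : ℝ) :
    MeasureTheory.Integrable fun v : ℝ => Real.exp (-b * v ^ 2 + a * v + c) := by
  have h := (integrable_cexp_quadratic (b := (b : ℂ)) (by simpa using hb) a c).norm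
  refine h.congr (Filter.Eventually.of_forall fun v => ?_)
  simp only [Complex.norm_exp]
  congr 1
  have : (-(b : ℂ) * v ^ 2 + a * v + c) = ((-b * v ^ 2 + a * v + c : ℝ) : ℂ) := by push_cast; ring
  rw [this, Complex.ofReal_re]

theorem integrable_exp_quadratic_abs {b : ℝ} (hb : 0 < b) (a c : ℝ) :
    MeasureTheory.Integrable fun v : ℝ => Real.exp (-b * v ^ 2 + a * |v| + c) := by
  refine ((integrable_exp_quadratic hb a c).add (integrable_exp_quadratic hb (-a) c)).mono'
    (by fun_prop) (Filter.Eventually.of_forall fun v => ?_)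
  rw [Real.norm_eq_abs, abs_of_pos (Real.exp_pos _), Pi.add_apply]
  rcases abs_cases v with ⟨h, _⟩ | ⟨h, _⟩ <;> rw [h]
  · linarith [Real.exp_pos (-b * v ^ 2 + -a * v + c)]
  · rw [show a * -v = -a * v by ring]
    linarith [Real.exp_pos (-b * v ^ 2 + a * v + c)]

/-- The `n`-th moment of `2 (z + ε V)` for a centred Gaussian `V` with density proportional to
`exp (-v²)`. For `ε = i` these are the values `H_n(z)`. -/
noncomputable def shiftedMoment (z ε : ℂ) (n : ℕ) : ℂ :=
  (Real.sqrt Real.pi : ℂ)⁻¹ * ∫ v : ℝ, (2 * (z + ε * v)) ^ n * (Real.exp (-v ^ 2) : ℂ)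

theorem integrable_shiftedMoment (z ε : ℂ) (n : ℕ) :
    MeasureTheory.Integrable fun v : ℝ => (2 * (z + ε * v)) ^ n * (Real.exp (-v ^ 2) : ℂ) := by
  have : (fun v : ℝ => (2 * (z + ε * v)) ^ n * (Real.exp (-v ^ 2) : ℂ)) = fun v : ℝ =>
      ∑ i ∈ Finset.range (n + 1), (2 ^ n * z ^ i * ε ^ (n - i) * n.choose i) *
        ((v ^ (n - i) * Real.exp (-v ^ 2) : ℝ) : ℂ) := by
    ext v
    rw [mul_pow, add_pow, Finset.mul_sum, Finset.sum_mul]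
    refine Finset.sum_congr rfl fun i _ => ?_
    push_cast
    ring
  rw [this]
  exact MeasureTheory.integrable_finsetSum _ fun i _ =>
    (integrable_pow_mul_exp_neg_sq (n - i)).ofReal.const_mul _

theorem sqrt_pi_ne_zero : (Real.sqrt Real.pi : ℂ) ≠ 0 := by
  exact_mod_cast (Real.sqrt_pos.2 Real.pi_pos).ne'

theorem shiftedMoment_zero (z ε : ℂ) : shiftedMoment z ε 0 = 1 := by
  have h := integral_gaussian 1
  simp only [neg_mul, one_mul, div_one] at h
  simp only [shiftedMoment, pow_zero, one_mul]
  rw [integral_complex_ofReal, h, inv_mul_cancel₀ sqrt_pi_ne_zero]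

theorem shiftedMoment_succ (z ε : ℂ) (n : ℕ) :
    shiftedMoment z ε (n + 1) =
      2 * z * shiftedMoment z ε n + 2 * n * ε ^ 2 * shiftedMoment z ε (n - 1) := by
  have hder : ∀ v : ℝ, HasDerivAt
      (fun v : ℝ => (2 * (z + ε * v)) ^ n * (Real.exp (-v ^ 2) : ℂ))
      (2 * n * ε * ((2 * (z + ε * v)) ^ (n - 1) * (Real.exp (-v ^ 2) : ℂ)) -
        (2 * v) * ((2 * (z + ε * v)) ^ n * (Real.exp (-v ^ 2) : ℂ))) v := by
    intro v
    have h1 : HasDerivAt (fun y : ℝ => Real.exp (-y ^ 2)) (Real.exp (-v ^ 2) * (-(2 * v))) v := by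
      have := ((hasDerivAt_pow 2 v).neg).exp
      simpa using this
    have h2 : HasDerivAt (fun y : ℝ => 2 * (z + ε * (y : ℂ))) (2 * (ε * 1)) v :=
      (((hasDerivAt_id v).ofReal_comp.const_mul ε).const_add z).const_mul 2
    refine ((h2.pow n).mul h1.ofReal_comp).congr_deriv ?_
    push_cast
    simp only [Pi.pow_apply]
    ring
  have hi : MeasureTheory.Integrable fun v : ℝ =>
      2 * v * ((2 * (z + ε * v)) ^ n * (Real.exp (-v ^ 2) : ℂ)) := by
    by_cases hε : ε = 0
    · subst hε
      simp only [zero_mul, add_zero]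
      have := (integrable_pow_mul_exp_neg_sq 1).ofReal (𝕜 := ℂ) |>.const_mul (2 * (2 * z) ^ n)
      refine this.congr (Filter.Eventually.of_forall fun v => ?_)
      simp only [pow_one, RCLike.ofReal_mul]
      simp only [Complex.coe_algebraMap]
      ring
    · have h1 := integrable_shiftedMoment z ε (n + 1)
      have h2 := (integrable_shiftedMoment z ε n).const_mul (2 * z)
      refine ((h1.sub h2).const_mul ε⁻¹).congr (Filter.Eventually.of_forall fun v => ?_)
      simp only [Pi.sub_apply]
      field_simp
      ring
  have hzero := MeasureTheory.integral_eq_zero_of_hasDerivAt_of_integrable hder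
    (((integrable_shiftedMoment z ε (n - 1)).const_mul (2 * n * ε)).sub hi)
    (integrable_shiftedMoment z ε n)
  rw [MeasureTheory.integral_sub ((integrable_shiftedMoment z ε (n - 1)).const_mul _) hi,
    MeasureTheory.integral_const_mul, sub_eq_zero] at hzero
  have hsplit : ∫ v : ℝ, (2 * (z + ε * v)) ^ (n + 1) * (Real.exp (-v ^ 2) : ℂ) =
      2 * z * (∫ v : ℝ, (2 * (z + ε * v)) ^ n * (Real.exp (-v ^ 2) : ℂ)) +
      ε * ∫ v : ℝ, 2 * v * ((2 * (z + ε * v)) ^ n * (Real.exp (-v ^ 2) : ℂ)) := by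
    rw [← MeasureTheory.integral_const_mul, ← MeasureTheory.integral_const_mul,
      ← MeasureTheory.integral_add ((integrable_shiftedMoment z ε n).const_mul _)
        (hi.const_mul _)]
    refine MeasureTheory.integral_congr_ae (Filter.Eventually.of_forall fun v => ?_)
    simp only
    ring
  simp only [shiftedMoment]
  rw [hsplit, ← hzero]
  ring

theorem norm_two_mul_add_le (z ε ζ : ℂ) (v : ℝ) :
    ‖ζ * (2 * (z + ε * v))‖ ≤ 2 * ‖ζ‖ * (‖z‖ + ‖ε‖ * |v|) := by
  rw [norm_mul, norm_mul, Complex.norm_ofNat]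
  have : ‖z + ε * v‖ ≤ ‖z‖ + ‖ε‖ * |v| := by
    refine (norm_add_le _ _).trans_eq ?_
    rw [norm_mul, Complex.norm_real, Real.norm_eq_abs]
  nlinarith [norm_nonneg ζ, mul_le_mul_of_nonneg_left this (norm_nonneg ζ)]

theorem cpow_half_eq_sqrt {a : ℝ} (ha : 0 ≤ a) : (a : ℂ) ^ (1 / 2 : ℂ) = (Real.sqrt a : ℂ) := by
  rw [Real.sqrt_eq_rpow, Complex.ofReal_cpow ha]
  norm_num

theorem hasSum_shiftedMoment (z ε ζ : ℂ) :
    HasSum (fun n : ℕ => ζ ^ n / n.factorial * shiftedMoment z ε n)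
      (Complex.exp (2 * ζ * z + ε ^ 2 * ζ ^ 2)) := by
  have h := MeasureTheory.hasSum_integral_of_dominated_convergence
    (μ := MeasureTheory.volume)
    (F := fun (n : ℕ) (v : ℝ) =>
      ζ ^ n / n.factorial * ((2 * (z + ε * v)) ^ n * (Real.exp (-v ^ 2) : ℂ)))
    (f := fun v : ℝ => Complex.exp (-1 * v ^ 2 + 2 * ζ * ε * v + 2 * ζ * z))
    (fun (n : ℕ) (v : ℝ) => (2 * ‖ζ‖ * (‖z‖ + ‖ε‖ * |v|)) ^ n / n.factorial * Real.exp (-v ^ 2))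
    (fun n => ((integrable_shiftedMoment z ε n).const_mul _).aestronglyMeasurable)
    (fun n => Filter.Eventually.of_forall fun v => ?_)
    (Filter.Eventually.of_forall fun v => ?_) ?_ (Filter.Eventually.of_forall fun v => ?_)
  · have hint : ∫ v : ℝ, Complex.exp (-1 * v ^ 2 + 2 * ζ * ε * v + 2 * ζ * z) =
        (Real.sqrt Real.pi : ℂ) * Complex.exp (2 * ζ * z + ε ^ 2 * ζ ^ 2) := by
      rw [integral_cexp_quadratic (by norm_num), neg_neg, div_one,
        cpow_half_eq_sqrt Real.pi_pos.le]
      congr 2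
      ring
    rw [hint] at h
    have h2 := h.mul_left (Real.sqrt Real.pi : ℂ)⁻¹
    rw [inv_mul_cancel_left₀ sqrt_pi_ne_zero] at h2
    have e : (fun n : ℕ => ζ ^ n / n.factorial * shiftedMoment z ε n) = fun n : ℕ =>
        (Real.sqrt Real.pi : ℂ)⁻¹ * ∫ v : ℝ,
          ζ ^ n / n.factorial * ((2 * (z + ε * v)) ^ n * (Real.exp (-v ^ 2) : ℂ)) := by
      ext n
      rw [shiftedMoment, MeasureTheory.integral_const_mul]
      ring
    rw [e]
    exact h2
  · rw [← mul_assoc, norm_mul, Complex.norm_real, Real.norm_eq_abs, abs_of_pos (Real.exp_pos _)]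
    refine mul_le_mul_of_nonneg_right ?_ (Real.exp_pos _).le
    rw [div_mul_eq_mul_div, ← mul_pow, norm_div, norm_pow, Complex.norm_natCast]
    exact div_le_div_of_nonneg_right
      (pow_le_pow_left₀ (norm_nonneg _) (norm_two_mul_add_le _ _ _ _) _) (Nat.cast_nonneg _)
  · exact (Real.summable_pow_div_factorial _).mul_right _
  · have hi := integrable_exp_quadratic_abs one_pos (2 * ‖ζ‖ * ‖ε‖)
      (2 * ‖ζ‖ * ‖z‖)
    refine hi.congr (Filter.Eventually.of_forall fun v => ?_)
    simp only
    have hs := NormedSpace.expSeries_div_hasSum_exp (2 * ‖ζ‖ * (‖z‖ + ‖ε‖ * |v|))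
    rw [← Real.exp_eq_exp_ℝ] at hs
    rw [(hs.mul_right (Real.exp (-v ^ 2))).tsum_eq, ← Real.exp_add]
    congr 1
    ring
  · have hs := NormedSpace.expSeries_div_hasSum_exp (ζ * (2 * (z + ε * v)))
    rw [← Complex.exp_eq_exp_ℂ] at hs
    have h2 := hs.mul_right (Real.exp (-v ^ 2) : ℂ)
    rw [Complex.ofReal_exp, ← Complex.exp_add] at h2
    have e1 : (fun n : ℕ => ζ ^ n / n.factorial *
        ((2 * (z + ε * v)) ^ n * (Real.exp (-v ^ 2) : ℂ))) = fun n : ℕ =>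
        (ζ * (2 * (z + ε * v))) ^ n / n.factorial * Complex.exp ((-v ^ 2 : ℝ) : ℂ) := by
      ext n
      rw [mul_pow ζ, Complex.ofReal_exp]
      ring
    have e2 : (-1 * v ^ 2 + 2 * ζ * ε * v + 2 * ζ * z : ℂ) =
        ζ * (2 * (z + ε * v)) + ((-v ^ 2 : ℝ) : ℂ) := by
      push_cast; ring
    rw [e1, e2]
    exact h2

theorem hermiteH_eq_shiftedMoment (n : ℕ) (x : ℝ) :
    (((hermiteH n).eval x : ℝ) : ℂ) = shiftedMoment x Complex.I n := by
  induction n using Nat.twoStepInduction with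
  | zero => rw [shiftedMoment_zero]; simp [hermiteH]
  | one =>
    rw [show 1 = 0 + 1 from rfl, shiftedMoment_succ, shiftedMoment_zero]
    simp [hermiteH]
  | more n h1 h2 =>
    rw [hermiteH_succ_succ, shiftedMoment_succ, ← h2, show n + 1 - 1 = n from rfl, ← h1]
    simp only [eval_sub, eval_mul, eval_X, eval_C, eval_ofNat, Complex.I_sq]
    push_cast
    ring

/-- The Hermite polynomials with all coefficients replaced by their absolute values. -/
noncomputable def hermiteAbs (x : ℝ) : ℕ → ℝ
  | 0 => 1
  | 1 => 2 * x
  | n + 2 => 2 * x * hermiteAbs x (n + 1) + 2 * (n + 1) * hermiteAbs x n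

theorem hermiteAbs_nonneg {x : ℝ} (hx : 0 ≤ x) (n : ℕ) : 0 ≤ hermiteAbs x n := by
  induction n using Nat.twoStepInduction with
  | zero => simp [hermiteAbs]
  | one => simpa [hermiteAbs] using hx
  | more n h1 h2 => rw [hermiteAbs]; positivity

theorem abs_eval_hermiteH_le (n : ℕ) (x : ℝ) :
    |(hermiteH n).eval x| ≤ hermiteAbs |x| n := by
  induction n using Nat.twoStepInduction with
  | zero => simp [hermiteH, hermiteAbs]
  | one => simp [hermiteH, hermiteAbs, abs_mul]
  | more n h1 h2 =>
    rw [hermiteH_succ_succ, hermiteAbs]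
    simp only [eval_sub, eval_mul, eval_X, eval_C, eval_ofNat]
    refine (abs_sub _ _).trans ?_
    rw [abs_mul, abs_mul, abs_mul, abs_two, abs_of_nonneg (by positivity : (0 : ℝ) ≤ 2 * (n + 1))]
    gcongr

theorem hermiteAbs_eq_shiftedMoment (n : ℕ) (x : ℝ) :
    (hermiteAbs x n : ℂ) = shiftedMoment x 1 n := by
  induction n using Nat.twoStepInduction with
  | zero => rw [shiftedMoment_zero]; simp [hermiteAbs]
  | one =>
    rw [show 1 = 0 + 1 from rfl, shiftedMoment_succ, shiftedMoment_zero]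
    simp [hermiteAbs]
  | more n h1 h2 =>
    rw [hermiteAbs, shiftedMoment_succ, ← h2, show n + 1 - 1 = n from rfl, ← h1]
    push_cast
    ring

theorem hasSum_hermiteH (x : ℝ) (ζ : ℂ) :
    HasSum (fun n : ℕ => ζ ^ n / n.factorial * (((hermiteH n).eval x : ℝ) : ℂ))
      (Complex.exp (2 * ζ * x - ζ ^ 2)) := by
  have h := hasSum_shiftedMoment x Complex.I ζ
  simp only [← hermiteH_eq_shiftedMoment, Complex.I_sq, neg_one_mul, ← sub_eq_add_neg] at h
  exact h

theorem hasSum_hermiteAbs (x ζ : ℝ) :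
    HasSum (fun n : ℕ => ζ ^ n / n.factorial * hermiteAbs x n)
      (Real.exp (2 * ζ * x + ζ ^ 2)) := by
  have h := hasSum_shiftedMoment x 1 ζ
  simp only [← hermiteAbs_eq_shiftedMoment, one_pow, one_mul] at h
  exact_mod_cast h

/-! ### Mehler's formula and Cramér's inequality -/

/-- Mehler's kernel, normalized as `∑ ηⁿ H_n(x) H_n(y) / (2ⁿ n!)`. -/
noncomputable def mehlerKernel (η x y : ℝ) : ℝ :=
  (Real.sqrt (1 - η ^ 2))⁻¹ *
    Real.exp ((2 * η * x * y - η ^ 2 * (x ^ 2 + y ^ 2)) / (1 - η ^ 2))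

/-- Mehler's formula. The first factor is written as a Gaussian moment, and the series in `n` is
summed under the integral sign by the generating function of the Hermite polynomials. -/
theorem hasSum_mehlerKernel {η : ℝ} (h0 : 0 ≤ η) (h1 : η < 1) (x y : ℝ) :
    HasSum (fun n : ℕ => η ^ n / (2 ^ n * n.factorial) *
      ((hermiteH n).eval x * (hermiteH n).eval y)) (mehlerKernel η x y) := by
  have hη : 0 < 1 - η ^ 2 := by nlinarith
  have hb : ((-(1 - η ^ 2) : ℝ) : ℂ).re < 0 := by rw [Complex.ofReal_re]; linarith
  set ζ : ℝ → ℂ := fun v => η * (x + Complex.I * v) with hζ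
  have hζn : ∀ v, ‖ζ v‖ ≤ η * (|x| + |v|) := by
    intro v
    rw [hζ, norm_mul, Complex.norm_real, Real.norm_eq_abs, abs_of_nonneg h0]
    refine mul_le_mul_of_nonneg_left ((norm_add_le _ _).trans_eq ?_) h0
    rw [norm_mul, Complex.norm_real, Complex.norm_real, Complex.norm_I, one_mul]
    rfl
  have h := MeasureTheory.hasSum_integral_of_dominated_convergence
    (μ := MeasureTheory.volume)
    (F := fun (n : ℕ) (v : ℝ) =>
      ((η : ℂ) ^ n / (2 ^ n * n.factorial) * (((hermiteH n).eval y : ℝ) : ℂ)) *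
        ((2 * (x + Complex.I * v)) ^ n * (Real.exp (-v ^ 2) : ℂ)))
    (f := fun v : ℝ => Complex.exp (((-(1 - η ^ 2) : ℝ) : ℂ) * v ^ 2 +
      (2 * η * (y - η * x) * Complex.I) * v + (2 * η * x * y - η ^ 2 * x ^ 2)))
    (fun (n : ℕ) (v : ℝ) => (η * (|x| + |v|)) ^ n / n.factorial * hermiteAbs |y| n *
      Real.exp (-v ^ 2))
    (fun n => ((integrable_shiftedMoment x Complex.I n).const_mul _).aestronglyMeasurable)
    (fun n => Filter.Eventually.of_forall fun v => ?_)
    (Filter.Eventually.of_forall fun v => ?_) ?_ (Filter.Eventually.of_forall fun v => ?_)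
  · have hint := integral_cexp_quadratic hb (2 * η * (y - η * x) * Complex.I)
      (2 * η * x * y - η ^ 2 * x ^ 2)
    rw [hint] at h
    have h2 := h.mul_left (Real.sqrt Real.pi : ℂ)⁻¹
    have e1 : (fun n : ℕ => (Real.sqrt Real.pi : ℂ)⁻¹ * ∫ v : ℝ,
        ((η : ℂ) ^ n / (2 ^ n * n.factorial) * (((hermiteH n).eval y : ℝ) : ℂ)) *
        ((2 * (x + Complex.I * v)) ^ n * (Real.exp (-v ^ 2) : ℂ))) = fun n : ℕ =>
        ((η ^ n / (2 ^ n * n.factorial) * ((hermiteH n).eval x * (hermiteH n).eval y) : ℝ) : ℂ) := by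
      ext n
      push_cast
      rw [MeasureTheory.integral_const_mul, hermiteH_eq_shiftedMoment n x, shiftedMoment]
      push_cast
      ring
    have e2 : (Real.sqrt Real.pi : ℂ)⁻¹ * (((Real.pi : ℂ) / -((-(1 - η ^ 2) : ℝ) : ℂ)) ^ (1 / 2 : ℂ) *
        Complex.exp ((2 * η * x * y - η ^ 2 * x ^ 2) - (2 * η * (y - η * x) * Complex.I) ^ 2 /
          (4 * ((-(1 - η ^ 2) : ℝ) : ℂ)))) = (mehlerKernel η x y : ℂ) := by
      have e3 : (Real.pi : ℂ) / -((-(1 - η ^ 2) : ℝ) : ℂ) = ((Real.pi / (1 - η ^ 2) : ℝ) : ℂ) := by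
        push_cast; ring
      rw [e3, cpow_half_eq_sqrt (by positivity), Real.sqrt_div Real.pi_pos.le, mehlerKernel,
        Complex.ofReal_mul, Complex.ofReal_exp, Complex.ofReal_div, ← mul_assoc, div_eq_mul_inv,
        inv_mul_cancel_left₀ sqrt_pi_ne_zero, Complex.ofReal_inv]
      congr 2
      have hne : (1 - (η : ℂ) ^ 2) ≠ 0 := by exact_mod_cast hη.ne'
      push_cast
      rw [mul_pow _ Complex.I, Complex.I_sq]
      field_simp
      ring
    rw [e1, e2] at h2
    exact_mod_cast h2
  · have e : ((η : ℂ) ^ n / (2 ^ n * n.factorial) * (((hermiteH n).eval y : ℝ) : ℂ)) *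
        ((2 * (x + Complex.I * v)) ^ n * (Real.exp (-v ^ 2) : ℂ)) =
        ζ v ^ n / n.factorial * (((hermiteH n).eval y : ℝ) : ℂ) * (Real.exp (-v ^ 2) : ℂ) := by
      rw [hζ, mul_pow, mul_pow]
      field_simp
    rw [e, norm_mul, norm_mul, norm_div, norm_pow, Complex.norm_natCast, Complex.norm_real,
      Complex.norm_real, Real.norm_eq_abs, Real.norm_eq_abs, abs_of_pos (Real.exp_pos _)]
    have := hermiteAbs_nonneg (abs_nonneg y) n
    gcongr
    · exact hζn v
    · exact abs_eval_hermiteH_le n y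
  · exact (hasSum_hermiteAbs |y| (η * (|x| + |v|))).summable.mul_right _
  · refine (integrable_exp_quadratic_abs hη (2 * η * |y| + 2 * η ^ 2 * |x|)
      (2 * η * |x| * |y| + η ^ 2 * |x| ^ 2)).congr (Filter.Eventually.of_forall fun v => ?_)
    simp only
    rw [((hasSum_hermiteAbs |y| (η * (|x| + |v|))).mul_right (Real.exp (-v ^ 2))).tsum_eq,
      ← Real.exp_add]
    congr 1
    rw [← sq_abs v]
    ring
  · have h2 := (hasSum_hermiteH y (ζ v)).mul_right (Real.exp (-v ^ 2) : ℂ)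
    have e1 : (fun n : ℕ => ((η : ℂ) ^ n / (2 ^ n * n.factorial) *
        (((hermiteH n).eval y : ℝ) : ℂ)) *
        ((2 * (x + Complex.I * v)) ^ n * (Real.exp (-v ^ 2) : ℂ))) = fun n : ℕ =>
        ζ v ^ n / n.factorial * (((hermiteH n).eval y : ℝ) : ℂ) * (Real.exp (-v ^ 2) : ℂ) := by
      ext n
      rw [hζ, mul_pow, mul_pow]
      field_simp
    have e2 : Complex.exp (((-(1 - η ^ 2) : ℝ) : ℂ) * v ^ 2 +
        (2 * η * (y - η * x) * Complex.I) * v + (2 * η * x * y - η ^ 2 * x ^ 2)) =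
        Complex.exp (2 * ζ v * y - ζ v ^ 2) * (Real.exp (-v ^ 2) : ℂ) := by
      rw [Complex.ofReal_exp, ← Complex.exp_add, hζ]
      congr 1
      push_cast
      linear_combination ((η : ℂ) ^ 2 * v ^ 2) * Complex.I_sq
    rw [e1, e2]
    exact h2

/-- A weak form of Cramér's inequality for the Hermite functions. It is read off from the diagonal
of Mehler's formula at `η = 1 - 1 / (n + 2)`. -/
theorem sq_eval_hermiteH_le (n : ℕ) (x : ℝ) :
    ((hermiteH n).eval x) ^ 2 ≤
      2 ^ n * n.factorial * (3 * Real.sqrt (n + 2)) * Real.exp (x ^ 2) := by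
  set η : ℝ := (n + 1) / (n + 2) with hη
  have hn : (0 : ℝ) ≤ n := n.cast_nonneg
  have h0 : 0 < η := by positivity
  have h1 : η < 1 := by rw [hη, div_lt_one (by positivity)]; linarith
  have h := le_hasSum (hasSum_mehlerKernel h0.le h1 x x) n fun k _ => by
    have := mul_self_nonneg ((hermiteH k).eval x)
    positivity
  have hk : mehlerKernel η x x ≤ Real.sqrt (n + 2) * Real.exp (x ^ 2) := by
    have hη2 : 1 / (n + 2 : ℝ) ≤ 1 - η ^ 2 := by
      have : 1 - η = 1 / (n + 2 : ℝ) := by rw [hη]; field_simp; ring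
      nlinarith
    have hpos : 0 < 1 - η ^ 2 := lt_of_lt_of_le (by positivity) hη2
    rw [mehlerKernel]
    refine mul_le_mul ?_ (Real.exp_le_exp.2 ?_) (Real.exp_pos _).le (Real.sqrt_nonneg _)
    · rw [← Real.sqrt_inv]
      refine Real.sqrt_le_sqrt ?_
      rw [inv_le_comm₀ hpos (by positivity), ← one_div]
      exact hη2
    · rw [div_le_iff₀ hpos]
      nlinarith [mul_nonneg (sq_nonneg x) (sq_nonneg (1 - η))]
  have hpow : (1 / η) ^ n ≤ 3 := by
    have e : 1 / η = 1 / (n + 1 : ℝ) + 1 := by rw [hη]; field_simp; ring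
    have h2 : 1 / η ≤ Real.exp (1 / (n + 1 : ℝ)) := by
      rw [e]; exact Real.add_one_le_exp _
    calc (1 / η) ^ n ≤ Real.exp (1 / (n + 1 : ℝ)) ^ n := pow_le_pow_left₀ (by positivity) h2 n
      _ = Real.exp (n * (1 / (n + 1 : ℝ))) := (Real.exp_nat_mul _ _).symm
      _ ≤ Real.exp 1 := Real.exp_le_exp.2 (by
        rw [mul_one_div, div_le_one (by positivity)]; linarith)
      _ ≤ 3 := Real.exp_one_lt_d9.le.trans (by norm_num)
  have h2 := h.trans hk
  have e : ((hermiteH n).eval x) ^ 2 = (2 ^ n * n.factorial * (1 / η) ^ n) *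
      (η ^ n / (2 ^ n * n.factorial) * ((hermiteH n).eval x * (hermiteH n).eval x)) := by
    rw [one_div_pow]
    field_simp
  rw [e]
  calc _ ≤ (2 ^ n * n.factorial * (1 / η) ^ n) * (Real.sqrt (n + 2) * Real.exp (x ^ 2)) :=
        mul_le_mul_of_nonneg_left h2 (by positivity)
    _ ≤ (2 ^ n * n.factorial * 3) * (Real.sqrt (n + 2) * Real.exp (x ^ 2)) := by gcongr
    _ = _ := by ring

theorem abs_eval_hermiteH_le_exp (n : ℕ) (x : ℝ) :
    |(hermiteH n).eval x| ≤
      Real.sqrt (2 ^ n * n.factorial * (3 * Real.sqrt (n + 2))) * Real.exp (x ^ 2 / 2) := by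
  refine abs_le_of_sq_le_sq ?_ (by positivity)
  rw [mul_pow, Real.sq_sqrt (by positivity), ← Real.exp_nat_mul]
  refine (sq_eval_hermiteH_le n x).trans_eq ?_
  congr 2
  push_cast; ring

theorem sixteen_pow_le_centralBinom {n : ℕ} (hn : 1 ≤ n) :
    (16 : ℝ) ^ n ≤ 4 * n * (n.centralBinom : ℝ) ^ 2 := by
  induction n, hn using Nat.le_induction with
  | base => norm_num [Nat.centralBinom, Nat.choose]
  | succ n hn ih =>
    have h : ((n : ℝ) + 1) * (n + 1).centralBinom = 2 * (2 * n + 1) * n.centralBinom := by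
      exact_mod_cast Nat.succ_mul_centralBinom_succ n
    have hn0 : (0 : ℝ) < n := by exact_mod_cast hn
    have hc : ((n + 1).centralBinom : ℝ) = 2 * (2 * n + 1) * n.centralBinom / (n + 1) := by
      rw [eq_div_iff (by positivity)]; linarith
    rw [hc, pow_succ 16]
    push_cast
    have e : 4 * ((n : ℝ) + 1) * (2 * (2 * n + 1) * n.centralBinom / (n + 1)) ^ 2 =
        4 * n * (n.centralBinom : ℝ) ^ 2 * (4 * (2 * n + 1) ^ 2 / (n * (n + 1))) := by
      field_simp
      norm_num
    rw [e]
    refine mul_le_mul ih ?_ (by norm_num) (by positivity)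
    rw [le_div_iff₀ (by positivity)]
    nlinarith

theorem centralBinom_sq_le_sixteen_pow (n : ℕ) :
    (n.centralBinom : ℝ) ^ 2 * (2 * n + 1) ≤ (16 : ℝ) ^ n := by
  induction n with
  | zero => simp
  | succ n ih =>
    have h : ((n : ℝ) + 1) * (n + 1).centralBinom = 2 * (2 * n + 1) * n.centralBinom := by
      exact_mod_cast Nat.succ_mul_centralBinom_succ n
    have hc : ((n + 1).centralBinom : ℝ) = 2 * (2 * n + 1) * n.centralBinom / (n + 1) := by
      rw [eq_div_iff (by positivity)]; linarith
    rw [hc, pow_succ 16]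
    push_cast
    have e : (2 * (2 * (n : ℝ) + 1) * n.centralBinom / (n + 1)) ^ 2 * (2 * (n + 1) + 1) =
        (n.centralBinom : ℝ) ^ 2 * (2 * n + 1) * (4 * (2 * n + 1) * (2 * n + 3) / (n + 1) ^ 2) := by
      field_simp
      ring
    rw [e]
    refine mul_le_mul ih ?_ (by positivity) (by positivity)
    rw [div_le_iff₀ (by positivity)]
    nlinarith

/-- `C(2N+2k, 2k) / C(2N, N)` is at most `4⁻ᴺ C(N+k, k)²` up to a factor linear in `N`. -/
theorem choose_div_centralBinom_le {N : ℕ} (hN : 1 ≤ N) (k : ℕ) :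
    ((2 * k + 2 * N).choose (2 * N) : ℝ) / N.centralBinom ≤
      8 * N * ((k + N).choose N : ℝ) ^ 2 / 4 ^ N := by
  have hk : (16 : ℝ) ^ k ≤ 4 * (k + 1) * (k.centralBinom : ℝ) ^ 2 := by
    rcases Nat.eq_zero_or_pos k with rfl | h
    · norm_num
    · refine (sixteen_pow_le_centralBinom h).trans ?_
      gcongr
      linarith
  have hn := sixteen_pow_le_centralBinom hN
  have hm := centralBinom_sq_le_sixteen_pow (k + N)
  have hN0 : (1 : ℝ) ≤ N := by exact_mod_cast hN
  have ck : (0 : ℝ) < k.centralBinom := by exact_mod_cast k.centralBinom_pos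
  have cn : (0 : ℝ) < N.centralBinom := by exact_mod_cast N.centralBinom_pos
  have cm : (0 : ℝ) < (k + N).centralBinom := by exact_mod_cast (k + N).centralBinom_pos
  have e : ((2 * k + 2 * N).choose (2 * N) : ℝ) * (k.centralBinom * N.centralBinom) =
      ((k + N).choose N : ℝ) ^ 2 * (k + N).centralBinom := by
    have f : ∀ j : ℕ, (j.centralBinom : ℝ) * (j.factorial * j.factorial) = (2 * j).factorial := by
      intro j
      rw [Nat.centralBinom, two_mul, ← mul_assoc]
      exact_mod_cast Nat.add_choose_mul_factorial_mul_factorial j j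
    have g1 : ((2 * k + 2 * N).choose (2 * N) : ℝ) * (2 * k).factorial * (2 * N).factorial =
        (2 * k + 2 * N).factorial := by
      exact_mod_cast Nat.add_choose_mul_factorial_mul_factorial (2 * k) (2 * N)
    have g2 : ((k + N).choose N : ℝ) * k.factorial * N.factorial = (k + N).factorial := by
      exact_mod_cast Nat.add_choose_mul_factorial_mul_factorial k N
    have g3 := f (k + N)
    rw [mul_add, ← g1, ← g2, ← f k, ← f N] at g3
    have : (0 : ℝ) < k.factorial ^ 2 * N.factorial ^ 2 := by positivity
    refine mul_right_cancel₀ this.ne' ?_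
    linear_combination -g3
  have hsq : ((k + N).centralBinom * 4 ^ N : ℝ) ≤ 8 * N * (k.centralBinom * N.centralBinom ^ 2) := by
    refine le_of_sq_le_sq ?_ (by positivity)
    have p1 : (16 : ℝ) ^ N * 16 ^ N ≤ (4 * N * (N.centralBinom : ℝ) ^ 2) *
        (4 * N * (N.centralBinom : ℝ) ^ 2) := mul_le_mul hn hn (by positivity) (by positivity)
    have p2 : ((k + N).centralBinom : ℝ) ^ 2 * (2 * (k + N : ℕ) + 1) * (16 ^ N * 16 ^ k) ≤
        16 ^ N * 16 ^ k * (4 * (k + 1) * (k.centralBinom : ℝ) ^ 2 * 16 ^ N) := by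
      calc _ ≤ (16 : ℝ) ^ (k + N) * (16 ^ N * 16 ^ k) :=
            mul_le_mul_of_nonneg_right hm (by positivity)
        _ = 16 ^ N * 16 ^ k * (16 ^ k * 16 ^ N) := by rw [pow_add]; ring
        _ ≤ _ := by gcongr
    have p3 : ((k + N).centralBinom : ℝ) ^ 2 * (2 * (k + N : ℕ) + 1) ≤
        4 * (k + 1) * (k.centralBinom : ℝ) ^ 2 * 16 ^ N := by
      have hp : (0 : ℝ) < 16 ^ N * 16 ^ k := by positivity
      refine le_of_mul_le_mul_right (p2.trans_eq (mul_comm _ _)) hp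
    push_cast at p3
    have hk0 : (0 : ℝ) ≤ k := k.cast_nonneg
    have p4 : ((k + N).centralBinom : ℝ) ^ 2 ≤ 4 * (k.centralBinom : ℝ) ^ 2 * 16 ^ N := by
      have hp : (0 : ℝ) < k + 1 := by positivity
      refine le_of_mul_le_mul_right ?_ hp
      have : ((k + N).centralBinom : ℝ) ^ 2 * (k + 1) ≤
          ((k + N).centralBinom : ℝ) ^ 2 * (2 * (k + N) + 1) := by
        gcongr; linarith
      linarith
    have e16 : ((4 : ℝ) ^ N) ^ 2 = 16 ^ N := by rw [← pow_mul, mul_comm, pow_mul]; norm_num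
    calc ((k + N).centralBinom * 4 ^ N : ℝ) ^ 2 = ((k + N).centralBinom : ℝ) ^ 2 * 16 ^ N := by
          rw [mul_pow, e16]
      _ ≤ 4 * (k.centralBinom : ℝ) ^ 2 * 16 ^ N * 16 ^ N := by gcongr
      _ = 4 * (k.centralBinom : ℝ) ^ 2 * (16 ^ N * 16 ^ N) := by ring
      _ ≤ 4 * (k.centralBinom : ℝ) ^ 2 * ((4 * N * (N.centralBinom : ℝ) ^ 2) *
        (4 * N * (N.centralBinom : ℝ) ^ 2)) := by gcongr
      _ = _ := by ring
  rw [div_le_div_iff₀ cn (by positivity)]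
  have hp : (0 : ℝ) < k.centralBinom * N.centralBinom := by positivity
  refine le_of_mul_le_mul_right ?_ hp
  calc _ = ((k + N).choose N : ℝ) ^ 2 * ((k + N).centralBinom * 4 ^ N) := by
        linear_combination 4 ^ N * e
    _ ≤ ((k + N).choose N : ℝ) ^ 2 * (8 * N * (k.centralBinom * N.centralBinom ^ 2)) := by gcongr
    _ = _ := by ring

/-! ### The quadrature error in the space of Mehler's kernel -/

section

variable {N : ℕ} {t : Fin N → ℝ}

theorem quadSum_X_pow_odd (ht : IsHermiteZeros N t) (m : ℕ) :
    quadSum t (X ^ (2 * m + 1)) = 0 := by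
  have h0 : quadError t (X ^ (2 * m + 1)) = 0 := by
    refine le_antisymm ((quadError_X_pow_le ht _).trans_eq ?_) (quadError_X_pow_nonneg ht _)
    rw [Finset.sum_eq_zero, mul_zero]
    rintro ⟨x, y⟩ hxy
    rw [Finset.HasAntidiagonal.mem_antidiagonal] at hxy
    simp only at hxy ⊢
    simp only [gaussianMean_X_pow_mul_hermiteH]
    -- One of `x - N`, `y - N` is odd, unless one of `x`, `y` is below `N`.
    rcases lt_or_ge x N with hx | hx
    · rw [Nat.descFactorial_eq_zero_iff_lt.2 hx]; simp
    rcases lt_or_ge y N with hy | hy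
    · rw [Nat.descFactorial_eq_zero_iff_lt.2 hy]; simp
    rcases Nat.even_or_odd' (x - N) with ⟨a, ha | ha⟩
    · obtain ⟨b, hb⟩ : ∃ b, y - N = 2 * b + 1 := ⟨(y - N) / 2, by omega⟩
      rw [hb, gaussianMean_X_pow_odd]; ring
    · rw [ha, gaussianMean_X_pow_odd]; ring
  rw [quadError_apply, gaussianMean_X_pow_odd] at h0
  linarith

theorem quadSum_C_mul (t : Fin N → ℝ) (a : ℝ) (p : ℝ[X]) :
    quadSum t (C a * p) = a * quadSum t p := by
  rw [← smul_eq_C_mul, map_smul, smul_eq_mul]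

/-- Proved for all `x ^ a * H_j` with `a + j` odd, by the recursion in `j`. -/
theorem quadSum_hermiteH_odd (ht : IsHermiteZeros N t) {n : ℕ} (hn : Odd n) :
    quadSum t (hermiteH n) = 0 := by
  have key : ∀ j a, Odd (a + j) → quadSum t (X ^ a * hermiteH j) = 0 := by
    intro j
    induction j using Nat.twoStepInduction with
    | zero =>
      rintro a ⟨m, hm⟩
      rw [hermiteH, mul_one, show a = 2 * m + 1 from hm]
      exact quadSum_X_pow_odd ht m
    | one =>
      rintro a ⟨m, hm⟩
      have : X ^ a * hermiteH 1 = C (2 : ℝ) * X ^ (2 * m + 1) := by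
        rw [← hm, show (C (2 : ℝ) : ℝ[X]) = 2 from rfl]
        simp only [hermiteH, derivative_one]
        ring
      rw [this, quadSum_C_mul, quadSum_X_pow_odd ht, mul_zero]
    | more j h1 h2 =>
      intro a ha
      have : X ^ a * hermiteH (j + 2) = C (2 : ℝ) * (X ^ (a + 1) * hermiteH (j + 1)) -
          C (2 * (j + 1 : ℝ)) * (X ^ a * hermiteH j) := by
        rw [hermiteH_succ_succ, show (C (2 : ℝ) : ℝ[X]) = 2 from rfl]
        ring
      rw [this, map_sub, quadSum_C_mul, quadSum_C_mul, h2 _ (by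
        rwa [show a + 1 + (j + 1) = a + (j + 2) by ring]), h1 _ (by
        rw [← add_assoc] at ha
        exact (Nat.odd_add.1 ha).2 even_two), mul_zero, mul_zero, sub_zero]
  simpa using key n 0 (by simpa using hn)

/-- The geometric mean of the bounds `abs_quadSum_hermiteH_le` and `abs_quadSum_hermiteH_add_le`.
-/
theorem sq_quadSum_hermiteH_le (ht : IsHermiteZeros N t) (hN : 1 ≤ N) (k : ℕ) :
    (quadSum t (hermiteH (2 * k + 2 * N))) ^ 2 /
      (2 ^ (2 * k + 2 * N) * (2 * k + 2 * N).factorial) ≤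
      408 * N / 2 ^ N * (k + (N + 1)).choose (N + 1) := by
  set n := 2 * k + 2 * N with hn
  set q := quadSum t (hermiteH n)
  have hN0 : (1 : ℝ) ≤ N := by exact_mod_cast hN
  -- The Cramér constant of `H_n` also serves for `H_{2k}`.
  set B : ℝ := 3 * Real.sqrt (n + 2)
  have hB : 0 < B := by positivity
  have f0 : ∀ j : ℕ, (0 : ℝ) < j.factorial := fun j => by positivity
  have ha := abs_quadSum_hermiteH_le ht n (A := Real.sqrt (2 ^ n * n.factorial * B)) (by positivity)
    (abs_eval_hermiteH_le_exp n)
  have ha2 : q ^ 2 / (2 ^ n * n.factorial) ≤ 4 * B := by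
    rw [div_le_iff₀ (by positivity)]
    calc q ^ 2 = |q| ^ 2 := (sq_abs _).symm
      _ ≤ (2 * Real.sqrt (2 ^ n * n.factorial * B)) ^ 2 := pow_le_pow_left₀ (abs_nonneg _) ha 2
      _ = 4 * B * (2 ^ n * n.factorial) := by
        rw [mul_pow, Real.sq_sqrt (by positivity)]; ring
  set A : ℝ := Real.sqrt (2 ^ (2 * k) * (2 * k).factorial * B)
  have hb := abs_quadSum_hermiteH_add_le ht hN (2 * k) (A := A) (by positivity) (fun x => by
    refine (abs_eval_hermiteH_le_exp (2 * k) x).trans ?_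
    refine mul_le_mul_of_nonneg_right (Real.sqrt_le_sqrt ?_) (Real.exp_pos _).le
    simp only [B]
    gcongr
    exact_mod_cast (by omega : 2 * k ≤ n))
  have hchoose : ((n.choose (2 * N) : ℕ) : ℝ) = n.factorial / ((2 * k).factorial * (2 * N).factorial) := by
    rw [eq_div_iff (by positivity), ← mul_assoc]
    exact_mod_cast Nat.add_choose_mul_factorial_mul_factorial (2 * k) (2 * N)
  have hdesc : ((n.descFactorial (2 * N) : ℕ) : ℝ) = n.factorial / (2 * k).factorial := by
    rw [eq_div_iff (by positivity), mul_comm]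
    have := Nat.factorial_mul_descFactorial (show 2 * N ≤ n by omega)
    rw [show n - 2 * N = 2 * k by omega] at this
    exact_mod_cast this
  have hcb : (N.centralBinom : ℝ) = (2 * N).factorial / (N.factorial * N.factorial) := by
    rw [eq_div_iff (by positivity), Nat.centralBinom, two_mul, ← mul_assoc]
    exact_mod_cast Nat.add_choose_mul_factorial_mul_factorial N N
  have hb2 : q ^ 2 / (2 ^ n * n.factorial) ≤
      144 * B * ((n.choose (2 * N) : ℝ) / N.centralBinom) := by
    rw [div_le_iff₀ (by positivity)]
    calc q ^ 2 = |q| ^ 2 := (sq_abs _).symm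
      _ ≤ _ := pow_le_pow_left₀ (abs_nonneg _) hb 2
      _ = _ := by
        rw [hdesc, hchoose, hcb, mul_pow, mul_pow, mul_pow, Real.sq_sqrt (by positivity), hn,
          pow_add, pow_mul 2 2 N]
        have := f0 n
        field_simp
        norm_num
        rw [← pow_mul, mul_comm N, pow_mul]
        norm_num
  have hc := choose_div_centralBinom_le hN k
  set Y := q ^ 2 / (2 ^ n * n.factorial)
  have hY : 0 ≤ Y := by positivity
  set c : ℝ := ((k + N).choose N : ℝ)
  have hYY : Y ^ 2 ≤ 4 * B * (144 * B * (8 * N * c ^ 2 / 4 ^ N)) := by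
    rw [sq]
    refine mul_le_mul ha2 (hb2.trans ?_) hY (by positivity)
    exact mul_le_mul_of_nonneg_left hc (by positivity)
  have hcc : ((k + (N + 1)).choose (N + 1) : ℝ) = c * ((k + N + 1) / (N + 1)) := by
    have := Nat.add_one_mul_choose_eq (k + N) N
    have h2 : ((k : ℝ) + N + 1) * c = (k + (N + 1)).choose (N + 1) * (N + 1) := by
      simp only [c]
      exact_mod_cast this
    rw [← mul_div_assoc, eq_div_iff (by positivity)]
    linarith
  have hBB : B ^ 2 = 9 * (n + 2) := by
    simp only [B]
    rw [mul_pow, Real.sq_sqrt (by positivity)]; norm_num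
  have h4 : ((2 : ℝ) ^ N) ^ 2 = 4 ^ N := by rw [← pow_mul, mul_comm, pow_mul]; norm_num
  refine le_of_sq_le_sq ?_ (by positivity)
  refine hYY.trans ?_
  rw [hcc, mul_pow, mul_pow, div_pow, h4]
  have hk0 : (0 : ℝ) ≤ k := k.cast_nonneg
  set R : ℝ := (k + N + 1) / (N + 1)
  have hR1 : 1 ≤ R := by
    simp only [R]; rw [le_div_iff₀ (by positivity)]; linarith
  have hnR : (n + 2 : ℝ) = 2 * (N + 1) * R := by
    simp only [R, hn]; push_cast; field_simp
  have e1 : 4 * B * (144 * B * (8 * N * c ^ 2 / 4 ^ N)) =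
      (c ^ 2 / 4 ^ N) * (4608 * N * B ^ 2) := by ring
  have e2 : (408 * N) ^ 2 / 4 ^ N * (c * R) ^ 2 = (c ^ 2 / 4 ^ N) * ((408 * N) ^ 2 * R ^ 2) := by ring
  rw [← mul_pow, e1, e2, hBB, hnR]
  refine mul_le_mul_of_nonneg_left ?_ (by positivity)
  have hRR : R ≤ R ^ 2 := by nlinarith
  -- The constant `408` is chosen with `2 * 82944 ≤ 408 ^ 2`.
  calc 4608 * N * (9 * (2 * (N + 1) * R)) = 82944 * (N * (N + 1)) * R := by ring
    _ ≤ 82944 * (N * (2 * N)) * R ^ 2 := by gcongr; linarith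
    _ ≤ _ := by nlinarith [mul_nonneg (sq_nonneg (N : ℝ)) (sq_nonneg R)]

/-- The squared worst-case error of the Gauss–Hermite rule in the reproducing kernel space of
Mehler's kernel. -/
theorem sum_quadWeight_mehlerKernel_le (ht : IsHermiteZeros N t) (hN : 1 ≤ N) {η : ℝ}
    (h0 : 0 ≤ η) (h1 : η < 1) :
    ∑ j, ∑ l, quadWeight t j * quadWeight t l * mehlerKernel η (t j) (t l) - 1 ≤
      408 * N * (η ^ 2 / (2 * (1 - η ^ 2))) ^ N / (1 - η ^ 2) ^ 2 := by
  have hη : η ^ 2 < 1 := by nlinarith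
  set f : ℕ → ℝ := fun n => η ^ n * ((quadSum t (hermiteH n)) ^ 2 / (2 ^ n * n.factorial)) with hf
  have hsum : HasSum f
      (∑ j, ∑ l, quadWeight t j * quadWeight t l * mehlerKernel η (t j) (t l)) := by
    have h := hasSum_sum fun j (_ : j ∈ Finset.univ) => hasSum_sum fun l (_ : l ∈ Finset.univ) =>
      (hasSum_mehlerKernel h0 h1 (t j) (t l)).mul_left (quadWeight t j * quadWeight t l)
    have e : f = fun n => ∑ j, ∑ l, quadWeight t j * quadWeight t l *
        (η ^ n / (2 ^ n * n.factorial) *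
          ((hermiteH n).eval (t j) * (hermiteH n).eval (t l))) := by
      ext n
      simp only [hf]
      rw [quadSum_apply, sq, Finset.sum_mul_sum, Finset.sum_div, Finset.mul_sum]
      refine Finset.sum_congr rfl fun j _ => ?_
      rw [Finset.sum_div, Finset.mul_sum]
      exact Finset.sum_congr rfl fun l _ => by ring
    rw [e]
    exact h
  have hf0 : f 0 = 1 := by
    simp only [hf, pow_zero, one_mul, Nat.factorial_zero, Nat.cast_one, div_one]
    rw [quadSum_apply]
    simp only [hermiteH, eval_one, mul_one]
    rw [sum_quadWeight ht hN, one_pow]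
  have hg : HasSum (fun k => f (2 * k + 2 * N))
      (∑ j, ∑ l, quadWeight t j * quadWeight t l * mehlerKernel η (t j) (t l) - 1) := by
    have h2 := hsum.update 0 0
    rw [hf0, zero_sub, neg_add_eq_sub] at h2
    have hinj : Function.Injective fun k => 2 * k + 2 * N := fun a b h => by
      simp only at h; omega
    have h3 := (hinj.hasSum_iff (f := Function.update f 0 0) (fun n hn => ?_)).2 h2
    · have e : (Function.update f 0 0 ∘ fun k => 2 * k + 2 * N) =
          fun k => f (2 * k + 2 * N) := by
        ext k
        rw [Function.comp_apply, Function.update_of_ne (by omega)]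
      rwa [e] at h3
    · rcases Nat.eq_zero_or_pos n with rfl | hpos
      · simp
      rw [Function.update_of_ne hpos.ne']
      have hq : quadSum t (hermiteH n) = 0 := by
        rcases lt_or_ge n (2 * N) with h | h
        · exact quadSum_hermiteH_eq_zero ht hpos.ne' h
        · refine quadSum_hermiteH_odd ht (Nat.not_even_iff_odd.1 fun ⟨m, hm⟩ => hn ⟨m - N, ?_⟩)
          simp only
          omega
      simp [hf, hq]
  have hb := (hasSum_choose_mul_geometric_of_norm_lt_one (N + 1) (r := η ^ 2)
    (by rwa [Real.norm_eq_abs, abs_of_nonneg (sq_nonneg _)])).mul_left (408 * N / 2 ^ N * η ^ (2 * N))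
  refine (hasSum_le (fun k => ?_) hg hb).trans_eq ?_
  · simp only [hf]
    have h := mul_le_mul_of_nonneg_left (sq_quadSum_hermiteH_le ht hN k)
      (by positivity : 0 ≤ η ^ (2 * k + 2 * N))
    refine h.trans_eq ?_
    rw [pow_add, pow_mul η 2 k]
    ring
  · have : 0 < 1 - η ^ 2 := by linarith
    rw [div_pow, mul_pow, pow_mul]
    field_simp
    ring

end

/-! ### Best approximation in the weighted `L²` space -/

/-- Functions `ℝ → ℂ` that are continuous and bounded; they lie in every weighted `L²` space. -/
def ContinuousBounded (f : ℝ → ℂ) : Prop := Continuous f ∧ ∃ C, ∀ x, ‖f x‖ ≤ C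

/-- The inner product of `L²(ℝ, ρ)`, conjugate linear in the second argument. -/
noncomputable def weightedInner (ρ : ℝ) (f g : ℝ → ℂ) : ℂ :=
  ∫ x : ℝ, f x * starRingEnd ℂ (g x) * (Real.exp (-x ^ 2 / (2 * ρ)) : ℂ)

theorem integrable_exp_weight {ρ : ℝ} (hρ : 0 < ρ) :
    MeasureTheory.Integrable fun x : ℝ => Real.exp (-x ^ 2 / (2 * ρ)) := by
  refine (integrable_exp_neg_mul_sq (b := 1 / (2 * ρ)) (by positivity)).congr
    (Filter.Eventually.of_forall fun x => ?_)
  simp only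
  congr 1
  ring

section

variable {f g h : ℝ → ℂ}

theorem ContinuousBounded.add (hf : ContinuousBounded f) (hg : ContinuousBounded g) :
    ContinuousBounded fun x => f x + g x := by
  obtain ⟨hf, C, hC⟩ := hf
  obtain ⟨hg, D, hD⟩ := hg
  exact ⟨hf.add hg, C + D, fun x => (norm_add_le _ _).trans (add_le_add (hC x) (hD x))⟩

theorem ContinuousBounded.sub (hf : ContinuousBounded f) (hg : ContinuousBounded g) :
    ContinuousBounded fun x => f x - g x := by
  obtain ⟨hf, C, hC⟩ := hf
  obtain ⟨hg, D, hD⟩ := hg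
  exact ⟨hf.sub hg, C + D, fun x => (norm_sub_le _ _).trans (add_le_add (hC x) (hD x))⟩

theorem ContinuousBounded.const_mul (hf : ContinuousBounded f) (a : ℂ) :
    ContinuousBounded fun x => a * f x := by
  obtain ⟨hf, C, hC⟩ := hf
  refine ⟨hf.const_mul a, ‖a‖ * C, fun x => ?_⟩
  rw [norm_mul]
  exact mul_le_mul_of_nonneg_left (hC x) (norm_nonneg _)

theorem ContinuousBounded.sum {ι : Type*} {s : Finset ι} {F : ι → ℝ → ℂ}
    (hF : ∀ i ∈ s, ContinuousBounded (F i)) : ContinuousBounded fun x => ∑ i ∈ s, F i x := by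
  choose! C hC using fun i hi => (hF i hi).2
  refine ⟨continuous_finsetSum _ fun i hi => (hF i hi).1, ∑ i ∈ s, C i, fun x => ?_⟩
  exact (norm_sum_le _ _).trans (Finset.sum_le_sum fun i hi => hC i hi x)

variable {ρ : ℝ}

theorem integrable_weightedInner (hρ : 0 < ρ) (hf : ContinuousBounded f)
    (hg : ContinuousBounded g) : MeasureTheory.Integrable fun x : ℝ =>
      f x * starRingEnd ℂ (g x) * (Real.exp (-x ^ 2 / (2 * ρ)) : ℂ) := by
  obtain ⟨hf, C, hC⟩ := hf
  obtain ⟨hg, D, hD⟩ := hg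
  have hc : Continuous fun x => f x * starRingEnd ℂ (g x) :=
    hf.mul (Complex.continuous_conj.comp hg)
  refine (integrable_exp_weight hρ).ofReal.bdd_mul (c := C * D) hc.aestronglyMeasurable
    (Filter.Eventually.of_forall fun x => ?_)
  rw [norm_mul, RCLike.norm_conj]
  exact mul_le_mul (hC x) (hD x) (norm_nonneg _) ((norm_nonneg _).trans (hC x))

theorem weightedInner_sub_left (hρ : 0 < ρ) (hf : ContinuousBounded f)
    (hg : ContinuousBounded g) (hh : ContinuousBounded h) :
    weightedInner ρ (fun x => f x - g x) h = weightedInner ρ f h - weightedInner ρ g h := by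
  rw [weightedInner, weightedInner, weightedInner, ← MeasureTheory.integral_sub
    (integrable_weightedInner hρ hf hh) (integrable_weightedInner hρ hg hh)]
  congr 1; ext x; ring

theorem weightedInner_conj (f g : ℝ → ℂ) :
    starRingEnd ℂ (weightedInner ρ f g) = weightedInner ρ g f := by
  rw [weightedInner, weightedInner, ← integral_conj]
  congr 1; ext x
  simp only [map_mul, Complex.conj_conj, Complex.conj_ofReal]
  ring

theorem weightedInner_sub_right (hρ : 0 < ρ) (hf : ContinuousBounded f)
    (hg : ContinuousBounded g) (hh : ContinuousBounded h) :
    weightedInner ρ h (fun x => f x - g x) = weightedInner ρ h f - weightedInner ρ h g := by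
  rw [← weightedInner_conj, weightedInner_sub_left hρ hf hg hh, map_sub, weightedInner_conj,
    weightedInner_conj]

theorem weightedInner_sum_left {ι : Type*} (hρ : 0 < ρ) (s : Finset ι) (c : ι → ℂ)
    {F : ι → ℝ → ℂ} (hF : ∀ i, ContinuousBounded (F i)) (hh : ContinuousBounded h) :
    weightedInner ρ (fun x => ∑ i ∈ s, c i * F i x) h =
      ∑ i ∈ s, c i * weightedInner ρ (F i) h := by
  simp only [weightedInner]
  simp_rw [← MeasureTheory.integral_const_mul]
  rw [← MeasureTheory.integral_finsetSum _ fun i _ =>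
    (integrable_weightedInner hρ (hF i) hh).const_mul _]
  congr 1; ext x
  rw [Finset.sum_mul, Finset.sum_mul]
  exact Finset.sum_congr rfl fun i _ => by ring

theorem weightedInner_sum_right {ι : Type*} (hρ : 0 < ρ) (s : Finset ι) (c : ι → ℂ)
    {F : ι → ℝ → ℂ} (hF : ∀ i, ContinuousBounded (F i)) (hh : ContinuousBounded h) :
    weightedInner ρ h (fun x => ∑ i ∈ s, c i * F i x) =
      ∑ i ∈ s, starRingEnd ℂ (c i) * weightedInner ρ h (F i) := by
  rw [← weightedInner_conj, weightedInner_sum_left hρ s c hF hh, map_sum]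
  exact Finset.sum_congr rfl fun i _ => by rw [map_mul, weightedInner_conj]

theorem integrable_norm_sq (hρ : 0 < ρ) (hf : ContinuousBounded f) :
    MeasureTheory.Integrable fun x : ℝ => ‖f x‖ ^ 2 * Real.exp (-x ^ 2 / (2 * ρ)) := by
  have := (integrable_weightedInner hρ hf hf).norm
  refine this.congr (Filter.Eventually.of_forall fun x => ?_)
  simp only [norm_mul, RCLike.norm_conj, Complex.norm_real, Real.norm_eq_abs, Real.abs_exp]
  ring

theorem weightedInner_self (f : ℝ → ℂ) :
    weightedInner ρ f f = ((∫ x : ℝ, ‖f x‖ ^ 2 * Real.exp (-x ^ 2 / (2 * ρ)) : ℝ) : ℂ) := by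
  rw [weightedInner, ← integral_complex_ofReal]
  congr 1; ext x
  rw [Complex.mul_conj, Complex.normSq_eq_norm_sq]
  push_cast; ring

/-- The squared norm of `L²(ℝ, ρ)`. -/
noncomputable def weightedNormSq (ρ : ℝ) (f : ℝ → ℂ) : ℝ :=
  ∫ x : ℝ, ‖f x‖ ^ 2 * Real.exp (-x ^ 2 / (2 * ρ))

theorem weightedNormSq_nonneg (ρ : ℝ) (f : ℝ → ℂ) : 0 ≤ weightedNormSq ρ f :=
  MeasureTheory.integral_nonneg fun x => by positivity

/-- Subtracting an orthogonal function does not decrease the norm. -/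
theorem weightedNormSq_le_sub (hρ : 0 < ρ) (hf : ContinuousBounded f)
    (hg : ContinuousBounded g) (h0 : weightedInner ρ f g = 0) :
    weightedNormSq ρ f ≤ weightedNormSq ρ (fun x => f x - g x) := by
  have h1 : weightedInner ρ (fun x => f x - g x) (fun x => f x - g x) =
      weightedInner ρ f f + weightedInner ρ g g := by
    rw [weightedInner_sub_left hρ hf hg (hf.sub hg), weightedInner_sub_right hρ hf hg hf,
      weightedInner_sub_right hρ hf hg hg, h0, ← weightedInner_conj f g, h0, map_zero]
    ring
  rw [weightedInner_self, weightedInner_self, weightedInner_self] at h1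
  have h2 : weightedNormSq ρ (fun x => f x - g x) = weightedNormSq ρ f + weightedNormSq ρ g := by
    exact_mod_cast h1
  rw [h2]
  linarith [weightedNormSq_nonneg ρ g]

theorem eq_zero_of_weightedInner_self (hρ : 0 < ρ) (hf : ContinuousBounded f)
    (h0 : weightedInner ρ f f = 0) : f = 0 := by
  rw [weightedInner_self, Complex.ofReal_eq_zero, MeasureTheory.integral_eq_zero_iff_of_nonneg
    (fun x => by positivity) (integrable_norm_sq hρ hf)] at h0
  have hc : Continuous fun x : ℝ => ‖f x‖ ^ 2 * Real.exp (-x ^ 2 / (2 * ρ)) := by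
    have := hf.1
    fun_prop
  have h1 := (hc.ae_eq_iff_eq MeasureTheory.volume continuous_zero).1 h0
  ext x
  have h2 := congrFun h1 x
  simpa [Real.exp_ne_zero] using h2

end

theorem continuousBounded_exp {l : ℂ} (hl : starRingEnd ℂ l = -l) :
    ContinuousBounded fun x : ℝ => Complex.exp (l * x) := by
  refine ⟨by fun_prop, 1, fun x => ?_⟩
  rw [Complex.norm_exp]
  have : l.re = 0 := by
    have := congrArg Complex.re hl
    simp only [Complex.conj_re, Complex.neg_re] at this
    linarith
  simp [this]

theorem continuousBounded_gaussian {σ : ℝ} (hσ : 0 < σ) :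
    ContinuousBounded fun x : ℝ => (Real.exp (-x ^ 2 / (2 * σ)) : ℂ) := by
  refine ⟨by fun_prop, 1, fun x => ?_⟩
  rw [Complex.norm_real, Real.norm_eq_abs, Real.abs_exp, Real.exp_le_one_iff]
  exact div_nonpos_of_nonpos_of_nonneg (by nlinarith [sq_nonneg x]) (by positivity)

theorem integral_exp_mul_gaussian {b : ℝ} (hb : 0 < b) (c : ℂ) :
    ∫ x : ℝ, Complex.exp (-b * x ^ 2 + c * x) =
      (Real.sqrt (Real.pi / b) : ℂ) * Complex.exp (c ^ 2 / (4 * b)) := by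
  have h := integral_cexp_quadratic (b := -(b : ℂ)) (by simpa using hb) c 0
  simp only [add_zero, neg_neg] at h
  rw [h, ← Complex.ofReal_div, cpow_half_eq_sqrt (by positivity)]
  congr 2
  rw [zero_sub, mul_neg, div_neg, neg_neg]

section

variable {ρ σ : ℝ} {l m : ℂ}

theorem weightedInner_exp_exp (hρ : 0 < ρ) (hm : starRingEnd ℂ m = -m) :
    weightedInner ρ (fun x => Complex.exp (l * x)) (fun x => Complex.exp (m * x)) =
      (Real.sqrt (2 * Real.pi * ρ) : ℂ) * Complex.exp ((l - m) ^ 2 * ρ / 2) := by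
  have h := integral_exp_mul_gaussian (b := 1 / (2 * ρ)) (by positivity) (l - m)
  have hρ' : (ρ : ℂ) ≠ 0 := by exact_mod_cast hρ.ne'
  rw [show Real.pi / (1 / (2 * ρ)) = 2 * Real.pi * ρ by field_simp] at h
  rw [show ((l - m) ^ 2 / (4 * ((1 / (2 * ρ) : ℝ) : ℂ))) = (l - m) ^ 2 * ρ / 2 by
    push_cast; field_simp; ring] at h
  rw [← h, weightedInner]
  congr 1; ext x
  rw [← Complex.exp_conj, map_mul, hm, Complex.conj_ofReal, Complex.ofReal_exp,
    ← Complex.exp_add, ← Complex.exp_add]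
  congr 1
  push_cast
  field_simp
  ring

theorem weightedInner_gaussian_exp (hρ : 0 < ρ) (hσ : 0 < σ) (hm : starRingEnd ℂ m = -m) :
    weightedInner ρ (fun x => (Real.exp (-x ^ 2 / (2 * σ)) : ℂ)) (fun x => Complex.exp (m * x)) =
      (Real.sqrt (2 * Real.pi * ρ) : ℂ) *
        ((Real.sqrt (σ / (σ + ρ)) : ℂ) * Complex.exp (σ * ρ * m ^ 2 / (2 * (σ + ρ)))) := by
  have h := integral_exp_mul_gaussian (b := (σ + ρ) / (2 * ρ * σ)) (by positivity) (-m)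
  have hρ' : (ρ : ℂ) ≠ 0 := by exact_mod_cast hρ.ne'
  have hσ' : (σ : ℂ) ≠ 0 := by exact_mod_cast hσ.ne'
  have hs : (σ + ρ : ℂ) ≠ 0 := by exact_mod_cast (by positivity : σ + ρ ≠ 0)
  rw [show Real.pi / ((σ + ρ) / (2 * ρ * σ)) = (2 * Real.pi * ρ) * (σ / (σ + ρ)) by field_simp,
    Real.sqrt_mul (by positivity)] at h
  rw [show ((-m) ^ 2 / (4 * (((σ + ρ) / (2 * ρ * σ) : ℝ) : ℂ))) =
    σ * ρ * m ^ 2 / (2 * (σ + ρ)) by push_cast; field_simp; ring] at h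
  rw [← mul_assoc, ← Complex.ofReal_mul, ← h, weightedInner]
  congr 1; ext x
  rw [← Complex.exp_conj, map_mul, hm, Complex.conj_ofReal, Complex.ofReal_exp, Complex.ofReal_exp,
    ← Complex.exp_add, ← Complex.exp_add]
  congr 1
  push_cast
  field_simp
  ring

theorem weightedInner_gaussian_self (hρ : 0 < ρ) (hσ : 0 < σ) :
    weightedInner ρ (fun x => (Real.exp (-x ^ 2 / (2 * σ)) : ℂ))
      (fun x => (Real.exp (-x ^ 2 / (2 * σ)) : ℂ)) =
      (Real.sqrt (2 * Real.pi * ρ) : ℂ) * (Real.sqrt (σ / (2 * ρ + σ)) : ℂ) := by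
  have h := integral_gaussian ((2 * ρ + σ) / (2 * ρ * σ))
  rw [show Real.pi / ((2 * ρ + σ) / (2 * ρ * σ)) = (2 * Real.pi * ρ) * (σ / (2 * ρ + σ)) by
    field_simp, Real.sqrt_mul (by positivity)] at h
  rw [← Complex.ofReal_mul, ← h, ← integral_complex_ofReal, weightedInner]
  congr 1; ext x
  rw [Complex.conj_ofReal, ← Complex.ofReal_mul, ← Complex.ofReal_mul, ← Real.exp_add,
    ← Real.exp_add]
  congr 2
  field_simp
  ring

variable {N : ℕ} {lam : Fin N → ℂ}

theorem continuousBounded_expSum (hl : ∀ j, starRingEnd ℂ (lam j) = -lam j) (c : Fin N → ℂ) :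
    ContinuousBounded fun x : ℝ => ∑ j, c j * Complex.exp (lam j * x) :=
  ContinuousBounded.sum fun j _ => (continuousBounded_exp (hl j)).const_mul _

theorem continuousBounded_approxResidual (hσ : 0 < σ) (hl : ∀ j, starRingEnd ℂ (lam j) = -lam j)
    (c : Fin N → ℂ) : ContinuousBounded (approxResidual σ lam c) :=
  (continuousBounded_gaussian hσ).sub (continuousBounded_expSum hl c)

/-- The coefficient system consists of the normal equations of best approximation. -/
theorem weightedInner_approxResidual_exp (hρ : 0 < ρ) (hσ : 0 < σ)
    (hl : ∀ j, starRingEnd ℂ (lam j) = -lam j) {γ : Fin N → ℂ}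
    (hγ : SolvesCoefficientSystem ρ σ lam γ) (k : Fin N) :
    weightedInner ρ (approxResidual σ lam γ) (fun x => Complex.exp (lam k * x)) = 0 := by
  have h1 := weightedInner_sub_left hρ (continuousBounded_gaussian hσ)
    (continuousBounded_expSum hl γ) (continuousBounded_exp (hl k))
  refine h1.trans ?_
  rw [weightedInner_sum_left hρ _ _ (fun j => continuousBounded_exp (hl j))
    (continuousBounded_exp (hl k)), weightedInner_gaussian_exp hρ hσ (hl k), ← hγ k,
    Finset.mul_sum, sub_eq_zero]
  refine Finset.sum_congr rfl fun j _ => ?_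
  rw [weightedInner_exp_exp hρ (hl k)]
  ring

theorem weightedNormSq_approxResidual_le (hρ : 0 < ρ) (hσ : 0 < σ)
    (hl : ∀ j, starRingEnd ℂ (lam j) = -lam j) {γ : Fin N → ℂ}
    (hγ : SolvesCoefficientSystem ρ σ lam γ) (c : Fin N → ℂ) :
    weightedNormSq ρ (approxResidual σ lam γ) ≤ weightedNormSq ρ (approxResidual σ lam c) := by
  have h0 : weightedInner ρ (approxResidual σ lam γ)
      (fun x => ∑ j, (c j - γ j) * Complex.exp (lam j * x)) = 0 := by
    rw [weightedInner_sum_right hρ _ _ (fun j => continuousBounded_exp (hl j))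
      (continuousBounded_approxResidual hσ hl γ)]
    refine Finset.sum_eq_zero fun j _ => ?_
    rw [weightedInner_approxResidual_exp hρ hσ hl hγ, mul_zero]
  have h1 := weightedNormSq_le_sub hρ (continuousBounded_approxResidual hσ hl γ)
    (continuousBounded_expSum hl _) h0
  have h2 : (fun x : ℝ => approxResidual σ lam γ x -
      ∑ j, (c j - γ j) * Complex.exp (lam j * x)) = approxResidual σ lam c := by
    ext x
    simp only [approxResidual, sub_mul, Finset.sum_sub_distrib]
    ring
  rwa [h2] at h1

/-- Exponentials with distinct frequencies are linearly independent (Dedekind's lemma). -/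
theorem eq_zero_of_expSum_eq_zero (hinj : Function.Injective lam) {c : Fin N → ℂ}
    (h : ∀ x : ℝ, ∑ j, c j * Complex.exp (lam j * x) = 0) : c = 0 := by
  let χ : Fin N → (Multiplicative ℝ →* ℂ) := fun j =>
    { toFun := fun x => Complex.exp (lam j * (Multiplicative.toAdd x : ℝ))
      map_one' := by simp
      map_mul' := fun x y => by rw [toAdd_mul, Complex.ofReal_add, mul_add, Complex.exp_add] }
  have hχ : Function.Injective χ := by
    intro j k hjk
    have h1 : ∀ x : ℝ, Complex.exp (lam j * x) = Complex.exp (lam k * x) := fun x =>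
      DFunLike.congr_fun hjk (Multiplicative.ofAdd x)
    have hd : ∀ l : ℂ, HasDerivAt (fun x : ℝ => Complex.exp (l * x)) l 0 := by
      intro l
      have := (((hasDerivAt_id (0 : ℝ)).ofReal_comp).const_mul l).cexp
      simpa using this
    have h2 := hd (lam j)
    rw [funext h1] at h2
    exact hinj (h2.unique (hd (lam k)))
  have hli := (linearIndependent_monoidHom (Multiplicative ℝ) ℂ).comp χ hχ
  rw [Fintype.linearIndependent_iff] at hli
  funext j
  refine hli c ?_ j
  ext x
  simpa [χ] using h (Multiplicative.toAdd x)

theorem existsUnique_solvesCoefficientSystem (hρ : 0 < ρ)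
    (hl : ∀ j, starRingEnd ℂ (lam j) = -lam j) (hinj : Function.Injective lam) :
    ∃! γ : Fin N → ℂ, SolvesCoefficientSystem ρ σ lam γ := by
  let G : Matrix (Fin N) (Fin N) ℂ := fun k j => Complex.exp ((lam j - lam k) ^ 2 * ρ / 2)
  have hG : Function.Injective G.mulVecLin := by
    rw [injective_iff_map_eq_zero]
    intro c hc
    have hc' : ∀ k, ∑ j, Complex.exp ((lam j - lam k) ^ 2 * ρ / 2) * c j = 0 := fun k =>
      congrFun hc k
    refine eq_zero_of_expSum_eq_zero hinj (c := c) fun x => ?_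
    have hV := continuousBounded_expSum hl c
    refine congrFun (eq_zero_of_weightedInner_self hρ hV ?_) x
    rw [weightedInner_sum_right hρ _ _ (fun j => continuousBounded_exp (hl j)) hV]
    refine Finset.sum_eq_zero fun k _ => ?_
    rw [weightedInner_sum_left hρ _ _ (fun j => continuousBounded_exp (hl j))
      (continuousBounded_exp (hl k))]
    have : ∑ j, c j * weightedInner ρ (fun x => Complex.exp (lam j * x))
        (fun x => Complex.exp (lam k * x)) = (Real.sqrt (2 * Real.pi * ρ) : ℂ) *
          ∑ j, Complex.exp ((lam j - lam k) ^ 2 * ρ / 2) * c j := by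
      rw [Finset.mul_sum]
      refine Finset.sum_congr rfl fun j _ => ?_
      rw [weightedInner_exp_exp hρ (hl k)]
      ring
    rw [this, hc' k, mul_zero, mul_zero]
  have hbij : Function.Bijective G.mulVecLin := ⟨hG, LinearMap.injective_iff_surjective.1 hG⟩
  obtain ⟨γ, hγ, huniq⟩ := hbij.existsUnique fun k =>
    (Real.sqrt (σ / (σ + ρ)) : ℂ) * Complex.exp (σ * ρ * lam k ^ 2 / (2 * (σ + ρ)))
  exact ⟨γ, fun k => congrFun hγ k, fun γ' h => huniq γ' (funext h)⟩

theorem weightedNormSq_approxResidual_ofReal (hρ : 0 < ρ) (hσ : 0 < σ)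
    (hl : ∀ j, starRingEnd ℂ (lam j) = -lam j) (c : Fin N → ℝ) :
    (weightedNormSq ρ (approxResidual σ lam fun j => (c j : ℂ)) : ℂ) =
      (Real.sqrt (2 * Real.pi * ρ) : ℂ) * ((Real.sqrt (σ / (2 * ρ + σ)) : ℂ) -
        ∑ k, c k * ((Real.sqrt (σ / (σ + ρ)) : ℂ) *
          (Complex.exp (σ * ρ * lam k ^ 2 / (2 * (σ + ρ))) +
            starRingEnd ℂ (Complex.exp (σ * ρ * lam k ^ 2 / (2 * (σ + ρ)))))) +
        ∑ j, ∑ k, c j * c k * Complex.exp ((lam j - lam k) ^ 2 * ρ / 2)) := by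
  have hg := continuousBounded_gaussian hσ
  have hs := continuousBounded_expSum hl fun j => (c j : ℂ)
  have he : ∀ j, ContinuousBounded fun x : ℝ => Complex.exp (lam j * x) := fun j =>
    continuousBounded_exp (hl j)
  have h1 : (weightedNormSq ρ (approxResidual σ lam fun j => (c j : ℂ)) : ℂ) =
      weightedInner ρ (approxResidual σ lam fun j => (c j : ℂ))
        (approxResidual σ lam fun j => (c j : ℂ)) := (weightedInner_self _).symm
  rw [h1]
  refine (weightedInner_sub_left hρ hg hs (hg.sub hs)).trans ?_
  rw [weightedInner_sub_right hρ hg hs hg, weightedInner_sub_right hρ hg hs hs,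
    ← weightedInner_conj (fun x => (Real.exp (-x ^ 2 / (2 * σ)) : ℂ))
      (fun x => ∑ j, (c j : ℂ) * Complex.exp (lam j * x)),
    weightedInner_sum_right hρ _ _ he hg, weightedInner_sum_right hρ _ _ he hs,
    weightedInner_gaussian_self hρ hσ]
  simp only [weightedInner_sum_left hρ _ _ he (he _), weightedInner_exp_exp hρ (hl _),
    weightedInner_gaussian_exp hρ hσ (hl _), map_sum, map_mul, Complex.conj_ofReal]
  obtain ⟨E, hE⟩ : ∃ E : Fin N → ℂ, ∀ k,
    Complex.exp (σ * ρ * lam k ^ 2 / (2 * (σ + ρ))) = E k := ⟨_, fun _ => rfl⟩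
  obtain ⟨G, hG⟩ : ∃ G : Fin N → Fin N → ℂ, ∀ j k,
    Complex.exp ((lam j - lam k) ^ 2 * ρ / 2) = G j k := ⟨_, fun _ _ => rfl⟩
  simp only [hE, hG]
  rw [mul_add, mul_sub, Finset.mul_sum, Finset.mul_sum]
  simp only [Finset.mul_sum, mul_add, Finset.sum_add_distrib]
  rw [Finset.sum_comm (f := fun j k => (Real.sqrt (2 * Real.pi * ρ) : ℂ) * (c j * c k * G j k))]
  have e1 : ∀ j k : Fin N, (c k : ℂ) * (c j * ((Real.sqrt (2 * Real.pi * ρ) : ℂ) * G j k)) =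
      (Real.sqrt (2 * Real.pi * ρ) : ℂ) * (c j * c k * G j k) := fun j k => by ring
  have e2 : ∀ (k : Fin N) (E : ℂ), (c k : ℂ) * ((Real.sqrt (2 * Real.pi * ρ) : ℂ) *
      ((Real.sqrt (σ / (σ + ρ)) : ℂ) * E)) = (Real.sqrt (2 * Real.pi * ρ) : ℂ) *
      (c k * ((Real.sqrt (σ / (σ + ρ)) : ℂ) * E)) := fun k E => by ring
  simp only [e1, e2]
  ring

end

/-! ### The approximation by exponentials -/

section

variable {ρ σ : ℝ} {N : ℕ} {t : Fin N → ℝ}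

theorem conj_frequency (ρ σ : ℝ) (t : Fin N → ℝ) (j : Fin N) :
    starRingEnd ℂ (frequency ρ σ t j) = -frequency ρ σ t j := by
  simp [frequency]

theorem frequency_injective (hρ : 0 < ρ) (hσ : 0 < σ) (ht : Function.Injective t) :
    Function.Injective (frequency ρ σ t) := by
  intro j k h
  have h0 : (Real.sqrt (2 * (ρ + σ) / (σ * (2 * ρ + σ))) : ℂ) ≠ 0 := by
    exact_mod_cast (Real.sqrt_pos.2 (by positivity)).ne'
  have h1 : (t j : ℂ) = t k :=
    mul_left_cancel₀ (mul_ne_zero (neg_ne_zero.2 Complex.I_ne_zero) h0) h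
  exact ht (by exact_mod_cast h1)

theorem frequency_sub_sq (hρ : 0 < ρ) (hσ : 0 < σ) (j k : Fin N) :
    (frequency ρ σ t j - frequency ρ σ t k) ^ 2 * ρ / 2 =
      ((-(ρ * (ρ + σ) / (σ * (2 * ρ + σ)) * (t j - t k) ^ 2) : ℝ) : ℂ) := by
  have h : (Real.sqrt (2 * (ρ + σ) / (σ * (2 * ρ + σ))) : ℂ) ^ 2 =
      ((2 * (ρ + σ) / (σ * (2 * ρ + σ)) : ℝ) : ℂ) := by
    rw [← Complex.ofReal_pow, Real.sq_sqrt (by positivity)]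
  have e : (frequency ρ σ t j - frequency ρ σ t k) ^ 2 * ρ / 2 = Complex.I ^ 2 *
      (Real.sqrt (2 * (ρ + σ) / (σ * (2 * ρ + σ))) : ℂ) ^ 2 * (t j - t k) ^ 2 * ρ / 2 := by
    simp only [frequency]; ring
  rw [e, h, Complex.I_sq]
  push_cast
  ring

theorem frequency_sq (hρ : 0 < ρ) (hσ : 0 < σ) (k : Fin N) :
    σ * ρ * frequency ρ σ t k ^ 2 / (2 * (σ + ρ)) =
      ((-(ρ / (2 * ρ + σ) * t k ^ 2) : ℝ) : ℂ) := by
  have h : (Real.sqrt (2 * (ρ + σ) / (σ * (2 * ρ + σ))) : ℂ) ^ 2 =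
      ((2 * (ρ + σ) / (σ * (2 * ρ + σ)) : ℝ) : ℂ) := by
    rw [← Complex.ofReal_pow, Real.sq_sqrt (by positivity)]
  have e : σ * ρ * frequency ρ σ t k ^ 2 / (2 * (σ + ρ)) = Complex.I ^ 2 *
      (Real.sqrt (2 * (ρ + σ) / (σ * (2 * ρ + σ))) : ℂ) ^ 2 * t k ^ 2 *
      (σ * ρ / (2 * (σ + ρ))) := by
    simp only [frequency]; ring
  have h1 : (σ : ℂ) ≠ 0 := by exact_mod_cast hσ.ne'
  have h2 : (ρ + σ : ℂ) ≠ 0 := by exact_mod_cast (by positivity : ρ + σ ≠ 0)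
  have h3 : (2 * ρ + σ : ℂ) ≠ 0 := by exact_mod_cast (by positivity : 2 * ρ + σ ≠ 0)
  rw [e, h, Complex.I_sq, add_comm (σ : ℂ)]
  push_cast
  field_simp

/-- Weights by which the quadrature rule at the Hermite zeros, multiplied by a Gaussian factor,
approximates the integral representation of `exp (-x² / (2 σ))` by exponentials. -/
noncomputable def quadCoefficient (ρ σ : ℝ) (t : Fin N → ℝ) (j : Fin N) : ℝ :=
  Real.sqrt ((ρ + σ) / (2 * ρ + σ)) * quadWeight t j *
    Real.exp (ρ / (2 * ρ + σ) * t j ^ 2)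

theorem weightedNormSq_quadCoefficient (hρ : 0 < ρ) (hσ : 0 < σ) (ht : IsHermiteZeros N t)
    (hN : 1 ≤ N) :
    weightedNormSq ρ (approxResidual σ (frequency ρ σ t)
        fun j => (quadCoefficient ρ σ t j : ℂ)) =
      Real.sqrt (2 * Real.pi * ρ) * Real.sqrt (σ / (2 * ρ + σ)) *
        (∑ j, ∑ k, quadWeight t j * quadWeight t k *
          mehlerKernel (ρ / (ρ + σ)) (t j) (t k) - 1) := by
  have h := weightedNormSq_approxResidual_ofReal hρ hσ (conj_frequency ρ σ t)
    (quadCoefficient ρ σ t)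
  simp only [frequency_sq hρ hσ, frequency_sub_sq hρ hσ, ← Complex.ofReal_exp,
    Complex.conj_ofReal] at h
  have h' : weightedNormSq ρ (approxResidual σ (frequency ρ σ t)
        fun j => (quadCoefficient ρ σ t j : ℂ)) =
      Real.sqrt (2 * Real.pi * ρ) * (Real.sqrt (σ / (2 * ρ + σ)) -
        ∑ k, quadCoefficient ρ σ t k * (Real.sqrt (σ / (σ + ρ)) *
          (Real.exp (-(ρ / (2 * ρ + σ) * t k ^ 2)) + Real.exp (-(ρ / (2 * ρ + σ) * t k ^ 2)))) +
        ∑ j, ∑ k, quadCoefficient ρ σ t j * quadCoefficient ρ σ t k *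
          Real.exp (-(ρ * (ρ + σ) / (σ * (2 * ρ + σ)) * (t j - t k) ^ 2))) := by
    exact_mod_cast h
  rw [h', mul_assoc (Real.sqrt (2 * Real.pi * ρ))]
  congr 1
  have e1 : ∀ k, quadCoefficient ρ σ t k * (Real.sqrt (σ / (σ + ρ)) *
      (Real.exp (-(ρ / (2 * ρ + σ) * t k ^ 2)) + Real.exp (-(ρ / (2 * ρ + σ) * t k ^ 2)))) =
      2 * Real.sqrt (σ / (2 * ρ + σ)) * quadWeight t k := by
    intro k
    have hs : Real.sqrt ((ρ + σ) / (2 * ρ + σ)) * Real.sqrt (σ / (σ + ρ)) =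
        Real.sqrt (σ / (2 * ρ + σ)) := by
      rw [← Real.sqrt_mul (by positivity)]
      congr 1
      field_simp
      ring
    have hexp : Real.exp (ρ / (2 * ρ + σ) * t k ^ 2) *
        Real.exp (-(ρ / (2 * ρ + σ) * t k ^ 2)) = 1 := by
      rw [← Real.exp_add, add_neg_cancel, Real.exp_zero]
    rw [quadCoefficient, ← hs]
    linear_combination (2 * Real.sqrt ((ρ + σ) / (2 * ρ + σ)) * Real.sqrt (σ / (σ + ρ)) *
      quadWeight t k) * hexp
  have e2 : ∀ j k, quadCoefficient ρ σ t j * quadCoefficient ρ σ t k *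
      Real.exp (-(ρ * (ρ + σ) / (σ * (2 * ρ + σ)) * (t j - t k) ^ 2)) =
      Real.sqrt (σ / (2 * ρ + σ)) * (quadWeight t j * quadWeight t k *
        mehlerKernel (ρ / (ρ + σ)) (t j) (t k)) := by
    intro j k
    have hη : 1 - (ρ / (ρ + σ)) ^ 2 = σ * (2 * ρ + σ) / (ρ + σ) ^ 2 := by field_simp; ring
    have hs : Real.sqrt (σ / (2 * ρ + σ)) * (Real.sqrt (1 - (ρ / (ρ + σ)) ^ 2))⁻¹ =
        Real.sqrt ((ρ + σ) / (2 * ρ + σ)) * Real.sqrt ((ρ + σ) / (2 * ρ + σ)) := by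
      rw [Real.mul_self_sqrt (by positivity), hη, ← Real.sqrt_inv, ← Real.sqrt_mul (by positivity),
        show σ / (2 * ρ + σ) * (σ * (2 * ρ + σ) / (ρ + σ) ^ 2)⁻¹ =
          ((ρ + σ) / (2 * ρ + σ)) ^ 2 by field_simp, Real.sqrt_sq (by positivity)]
    have hexp : Real.exp ((2 * (ρ / (ρ + σ)) * t j * t k -
        (ρ / (ρ + σ)) ^ 2 * (t j ^ 2 + t k ^ 2)) / (1 - (ρ / (ρ + σ)) ^ 2)) =
        Real.exp (ρ / (2 * ρ + σ) * t j ^ 2) * Real.exp (ρ / (2 * ρ + σ) * t k ^ 2) *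
          Real.exp (-(ρ * (ρ + σ) / (σ * (2 * ρ + σ)) * (t j - t k) ^ 2)) := by
      rw [← Real.exp_add, ← Real.exp_add, hη]
      congr 1
      field_simp
      ring
    rw [mehlerKernel, hexp, quadCoefficient, quadCoefficient]
    linear_combination (-(quadWeight t j * quadWeight t k *
      (Real.exp (ρ / (2 * ρ + σ) * t j ^ 2) * Real.exp (ρ / (2 * ρ + σ) * t k ^ 2) *
          Real.exp (-(ρ * (ρ + σ) / (σ * (2 * ρ + σ)) * (t j - t k) ^ 2))))) * hs
  rw [Finset.sum_congr rfl fun k _ => e1 k,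
    Finset.sum_congr rfl fun j _ => Finset.sum_congr rfl fun k _ => e2 j k]
  simp only [← Finset.mul_sum]
  rw [sum_quadWeight ht hN]
  ring

/-- The error bound, with `x` standing for `r / √(2 (2 r + 1))`. For `x < 1` the quadrature
coefficients are compared with, for `x ≥ 1` the zero vector. -/
theorem weightedL2Norm_approxResidual_le (hρ : 0 < ρ) (hσ : 0 < σ) (ht : IsHermiteZeros N t)
    (hN : 1 ≤ N) {γ : Fin N → ℂ} (hγ : SolvesCoefficientSystem ρ σ (frequency ρ σ t) γ) {x : ℝ}
    (hx : 0 < x) (hx2 : x ^ 2 = ρ ^ 2 / (2 * (σ * (2 * ρ + σ)))) :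
    weightedL2Norm ρ (approxResidual σ (frequency ρ σ t) γ) ≤
      Real.sqrt (3672 * Real.sqrt (2 * Real.pi * ρ)) * x ^ N * (N : ℝ) ^ (3 / 4 : ℝ) := by
  have hN0 : (1 : ℝ) ≤ N := by exact_mod_cast hN
  set K := Real.sqrt (2 * Real.pi * ρ)
  have hK : 0 ≤ K := Real.sqrt_nonneg _
  have hμ : Real.sqrt (σ / (2 * ρ + σ)) ≤ 1 := by
    refine Real.sqrt_le_one.2 ?_
    rw [div_le_one (by positivity)]; linarith
  have hμ0 := Real.sqrt_nonneg (σ / (2 * ρ + σ))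
  have main : weightedNormSq ρ (approxResidual σ (frequency ρ σ t) γ) ≤
      3672 * K * (x ^ N) ^ 2 * N := by
    rcases lt_or_ge x 1 with h1 | h1
    · have hle := weightedNormSq_approxResidual_le hρ hσ (conj_frequency ρ σ t) hγ
        fun j => (quadCoefficient ρ σ t j : ℂ)
      rw [weightedNormSq_quadCoefficient hρ hσ ht hN] at hle
      refine hle.trans ?_
      have hη0 : 0 ≤ ρ / (ρ + σ) := by positivity
      have hη1 : ρ / (ρ + σ) < 1 := by rw [div_lt_one (by positivity)]; linarith
      have hη : 1 - (ρ / (ρ + σ)) ^ 2 = σ * (2 * ρ + σ) / (ρ + σ) ^ 2 := by field_simp; ring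
      have hS := sum_quadWeight_mehlerKernel_le ht hN hη0 hη1
      have e : (ρ / (ρ + σ)) ^ 2 / (2 * (1 - (ρ / (ρ + σ)) ^ 2)) = x ^ 2 := by
        rw [hx2, hη]; field_simp
      rw [e] at hS
      -- `x < 1` keeps `η` away from `1`: `η² / (1 - η²) < 2`, that is, `η² < 2 / 3`.
      have h3 : (1 : ℝ) / 3 ≤ 1 - (ρ / (ρ + σ)) ^ 2 := by
        rw [hη, le_div_iff₀ (by positivity)]
        have : x ^ 2 < 1 := by nlinarith
        rw [hx2, div_lt_one (by positivity)] at this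
        nlinarith
      have h9 : 408 * N * (x ^ 2) ^ N / (1 - (ρ / (ρ + σ)) ^ 2) ^ 2 ≤ 3672 * N * (x ^ 2) ^ N := by
        rw [div_le_iff₀ (by positivity)]
        have : (1 : ℝ) / 9 ≤ (1 - (ρ / (ρ + σ)) ^ 2) ^ 2 := by nlinarith
        have h0 : 0 ≤ 3672 * N * (x ^ 2) ^ N := by positivity
        nlinarith [mul_le_mul_of_nonneg_left this h0]
      calc _ ≤ K * Real.sqrt (σ / (2 * ρ + σ)) * (3672 * N * (x ^ 2) ^ N) :=
            mul_le_mul_of_nonneg_left (hS.trans h9) (by positivity)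
        _ ≤ K * 1 * (3672 * N * (x ^ 2) ^ N) := by gcongr
        _ = _ := by rw [← pow_mul, ← pow_mul, mul_comm N 2]; ring
    · have hle := weightedNormSq_approxResidual_le hρ hσ (conj_frequency ρ σ t) hγ
        fun j => ((0 : ℝ) : ℂ)
      have h0 := weightedNormSq_approxResidual_ofReal hρ hσ (conj_frequency ρ σ t)
        fun _ => 0
      simp only [Complex.ofReal_zero, zero_mul, Finset.sum_const_zero, sub_zero, add_zero] at h0
      have h0' : weightedNormSq ρ (approxResidual σ (frequency ρ σ t) fun _ => 0) =
          K * Real.sqrt (σ / (2 * ρ + σ)) := by exact_mod_cast h0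
      simp only [Complex.ofReal_zero] at hle
      rw [h0'] at hle
      have hxN : 1 ≤ (x ^ N) ^ 2 := one_le_pow₀ (one_le_pow₀ h1)
      calc _ ≤ K * Real.sqrt (σ / (2 * ρ + σ)) := hle
        _ ≤ K * 1 := by gcongr
        _ ≤ 3672 * K * 1 * 1 := by linarith
        _ ≤ 3672 * K * (x ^ N) ^ 2 * N := by gcongr
  have hr : (N : ℝ) ≤ ((N : ℝ) ^ (3 / 4 : ℝ)) ^ 2 := by
    rw [← Real.rpow_natCast, ← Real.rpow_mul (by positivity)]
    calc (N : ℝ) = (N : ℝ) ^ (1 : ℝ) := (Real.rpow_one _).symm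
      _ ≤ _ := Real.rpow_le_rpow_of_exponent_le hN0 (by norm_num)
  refine Real.sqrt_le_iff.2 ⟨by positivity, main.trans ?_⟩
  rw [mul_pow, mul_pow, Real.sq_sqrt (by positivity)]
  gcongr

/-- The reversed solution solves the same system, because the frequencies are antisymmetric. -/
theorem apply_rev_of_solvesCoefficientSystem (hρ : 0 < ρ) (hσ : 0 < σ) (ht : IsHermiteZeros N t)
    {γ : Fin N → ℂ} (hγ : SolvesCoefficientSystem ρ σ (frequency ρ σ t) γ) (j : Fin N) :
    γ j = γ j.rev := by
  have hrev : ∀ j, frequency ρ σ t (Fin.rev j) = -frequency ρ σ t j := fun j => by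
    simp [frequency, ht.apply_rev]
  have h : SolvesCoefficientSystem ρ σ (frequency ρ σ t) fun j => γ j.rev := by
    intro k
    have := hγ k.rev
    rw [hrev, neg_sq] at this
    rw [← this, ← Equiv.sum_comp Fin.revPerm]
    refine Finset.sum_congr rfl fun i _ => ?_
    simp only [Fin.revPerm_apply, Fin.rev_rev, hrev]
    congr 3
    ring
  exact congrFun ((existsUnique_solvesCoefficientSystem hρ (conj_frequency ρ σ t)
    (frequency_injective hρ hσ ht.injective)).unique hγ h) j

theorem memWeightedL2_approxResidual (hρ : 0 < ρ) (hσ : 0 < σ) (γ : Fin N → ℂ) :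
    MemWeightedL2 ρ (approxResidual σ (frequency ρ σ t) γ) := by
  have h := continuousBounded_approxResidual hσ (conj_frequency ρ σ t) γ
  exact ⟨h.1.aestronglyMeasurable, integrable_norm_sq hρ h⟩

end

theorem cube_lt_three_pow {N : ℕ} (h : N ≠ 3) : N ^ 3 < 3 ^ N := by
  rcases lt_or_ge N 4 with h4 | h4
  · interval_cases N <;> simp_all
  · induction N, h4 using Nat.le_induction with
    | base => norm_num
    | succ n hn ih =>
      have := ih (by omega)
      rw [pow_succ 3]
      nlinarith [Nat.mul_le_mul hn hn, Nat.mul_le_mul (Nat.mul_le_mul hn hn) hn]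

theorem rpow_three_quarters_eq (N : ℕ) :
    (N : ℝ) ^ (3 / 4 : ℝ) = ((N ^ 3 : ℕ) : ℝ) ^ (1 / 4 : ℝ) := by
  push_cast
  rw [← Real.rpow_natCast, ← Real.rpow_mul (by positivity)]
  norm_num

theorem rpow_one_quarter_pow (N : ℕ) :
    ((3 : ℝ) ^ (1 / 4 : ℝ)) ^ N = ((3 ^ N : ℕ) : ℝ) ^ (1 / 4 : ℝ) := by
  push_cast
  rw [← Real.rpow_natCast, ← Real.rpow_natCast, ← Real.rpow_mul (by positivity),
    ← Real.rpow_mul (by positivity), mul_comm]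

theorem rpow_three_quarters_lt {N : ℕ} (h : N ≠ 3) :
    (N : ℝ) ^ (3 / 4 : ℝ) < ((3 : ℝ) ^ (1 / 4 : ℝ)) ^ N := by
  rw [rpow_three_quarters_eq, rpow_one_quarter_pow]
  exact Real.rpow_lt_rpow (by positivity) (by exact_mod_cast cube_lt_three_pow h) (by norm_num)

theorem rpow_three_quarters_le (N : ℕ) :
    (N : ℝ) ^ (3 / 4 : ℝ) ≤ ((3 : ℝ) ^ (1 / 4 : ℝ)) ^ N := by
  by_cases h : N = 3
  · subst h
    rw [rpow_three_quarters_eq, rpow_one_quarter_pow]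
  · exact (rpow_three_quarters_lt h).le

theorem exists_mul_pow_mul_rpow_le {c x : ℝ} (hc : 0 < c) (hx0 : 0 < x) (hx1 : x < 1) :
    ∃ C q : ℝ, 0 < C ∧ 0 < q ∧ q < 1 ∧
      ∀ N : ℕ, 1 ≤ N → c * x ^ N * (N : ℝ) ^ (3 / 4 : ℝ) ≤ C * q ^ N := by
  obtain ⟨q, hxq, hq1⟩ := exists_between hx1
  have hq0 := hx0.trans hxq
  have hy : |x / q| < 1 := by
    rw [abs_of_pos (by positivity), div_lt_one hq0]; exact hxq
  have ht := tendsto_self_mul_const_pow_of_abs_lt_one hy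
  obtain ⟨M, hM⟩ := ht.bddAbove_range
  have hM' : ∀ n : ℕ, n * (x / q) ^ n ≤ M := fun n => hM ⟨n, rfl⟩
  refine ⟨c * (|M| + 1), q, by positivity, hq0, hq1, fun N hN => ?_⟩
  have hN0 : (1 : ℝ) ≤ N := by exact_mod_cast hN
  have h1 : (N : ℝ) ^ (3 / 4 : ℝ) ≤ N := by
    calc _ ≤ (N : ℝ) ^ (1 : ℝ) := Real.rpow_le_rpow_of_exponent_le hN0 (by norm_num)
      _ = N := Real.rpow_one _
  have h2 := hM' N
  rw [div_pow, ← mul_div_assoc, div_le_iff₀ (by positivity)] at h2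
  calc c * x ^ N * (N : ℝ) ^ (3 / 4 : ℝ) ≤ c * x ^ N * N := by gcongr
    _ = c * (N * x ^ N) := by ring
    _ ≤ c * (M * q ^ N) := by gcongr
    _ ≤ c * ((|M| + 1) * q ^ N) := by
      have := le_abs_self M
      gcongr
      linarith
    _ = _ := by ring

theorem theorem3p1 (ρ : ℝ) (hρ : 0 < ρ) :
    ∃ c : ℝ, 0 < c ∧ ∀ σ : ℝ, 0 < σ → ∀ r : ℝ, r = ρ / σ →
      (∀ N : ℕ, 1 ≤ N → ∀ t : Fin N → ℝ, IsHermiteZeros N t →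
        (∃! γ : Fin N → ℂ, SolvesCoefficientSystem ρ σ (frequency ρ σ t) γ) ∧
        ∀ γ : Fin N → ℂ, SolvesCoefficientSystem ρ σ (frequency ρ σ t) γ →
          (∀ j : Fin N, γ j = γ j.rev) ∧
          MemWeightedL2 ρ (approxResidual σ (frequency ρ σ t) γ) ∧
          weightedL2Norm ρ (approxResidual σ (frequency ρ σ t) γ)
            < c * (r / Real.sqrt (2 * (2 * r + 1))) ^ N * (N : ℝ) ^ (3 / 4 : ℝ) ∧
          c * (r / Real.sqrt (2 * (2 * r + 1))) ^ N * (N : ℝ) ^ (3 / 4 : ℝ)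
            ≤ c * ((3 : ℝ) ^ (1 / 4 : ℝ) * r / Real.sqrt (2 * (2 * r + 1))) ^ N ∧
          (N ≠ 3 →
            c * (r / Real.sqrt (2 * (2 * r + 1))) ^ N * (N : ℝ) ^ (3 / 4 : ℝ)
              < c * ((3 : ℝ) ^ (1 / 4 : ℝ) * r / Real.sqrt (2 * (2 * r + 1))) ^ N)) ∧
      (r < 2 + Real.sqrt 6 →
        ∃ C q : ℝ, 0 < C ∧ 0 < q ∧ q < 1 ∧
          ∀ N : ℕ, 1 ≤ N → ∀ t : Fin N → ℝ, IsHermiteZeros N t →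
            ∀ γ : Fin N → ℂ, SolvesCoefficientSystem ρ σ (frequency ρ σ t) γ →
              weightedL2Norm ρ (approxResidual σ (frequency ρ σ t) γ) ≤ C * q ^ N) := by
  set c₀ := Real.sqrt (3672 * Real.sqrt (2 * Real.pi * ρ))
  have hc₀ : 0 ≤ c₀ := Real.sqrt_nonneg _
  refine ⟨c₀ + 1, by positivity, fun σ hσ r hr => ?_⟩
  have hr0 : 0 < r := by rw [hr]; positivity
  set x := r / Real.sqrt (2 * (2 * r + 1)) with hx
  have hx0 : 0 < x := by positivity
  have hxr : x ^ 2 = r ^ 2 / (2 * (2 * r + 1)) := by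
    rw [hx, div_pow, Real.sq_sqrt (by positivity)]
  have hx2 : x ^ 2 = ρ ^ 2 / (2 * (σ * (2 * ρ + σ))) := by
    rw [hxr, hr]; field_simp
  have hlt : ∀ N : ℕ, 1 ≤ N → ∀ t : Fin N → ℝ, IsHermiteZeros N t →
      ∀ γ : Fin N → ℂ, SolvesCoefficientSystem ρ σ (frequency ρ σ t) γ →
      weightedL2Norm ρ (approxResidual σ (frequency ρ σ t) γ) <
        (c₀ + 1) * x ^ N * (N : ℝ) ^ (3 / 4 : ℝ) := by
    intro N hN t ht γ hγ
    refine (weightedL2Norm_approxResidual_le hρ hσ ht hN hγ hx0 hx2).trans_lt ?_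
    have hN0 : (0 : ℝ) < N := by exact_mod_cast hN
    have h2 : 0 < x ^ N * (N : ℝ) ^ (3 / 4 : ℝ) := by positivity
    rw [mul_assoc c₀, mul_assoc (c₀ + 1)]
    exact mul_lt_mul_of_pos_right (lt_add_one _) h2
  refine ⟨fun N hN t ht => ⟨existsUnique_solvesCoefficientSystem hρ (conj_frequency ρ σ t)
    (frequency_injective hρ hσ ht.injective), fun γ hγ =>
    ⟨apply_rev_of_solvesCoefficientSystem hρ hσ ht hγ, memWeightedL2_approxResidual hρ hσ γ,
      hlt N hN t ht γ hγ, ?_, fun h3 => ?_⟩⟩, fun hr6 => ?_⟩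
  · rw [mul_div_assoc, mul_pow, mul_assoc, mul_comm (((3 : ℝ) ^ (1 / 4 : ℝ)) ^ N)]
    have := rpow_three_quarters_le N
    gcongr
  · rw [mul_div_assoc, mul_pow, mul_assoc, mul_comm (((3 : ℝ) ^ (1 / 4 : ℝ)) ^ N)]
    have := rpow_three_quarters_lt h3
    gcongr
  · have hx1 : x < 1 := by
      have h6 : Real.sqrt 6 ^ 2 = 6 := Real.sq_sqrt (by norm_num)
      have h60 := Real.sqrt_nonneg 6
      have h62 : 2 < Real.sqrt 6 := by nlinarith
      have : x ^ 2 < 1 := by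
        -- `r = 2 + √6` is the positive root of `r² = 2 (2 r + 1)`.
        rw [hxr, div_lt_one (by positivity)]
        nlinarith
      nlinarith
    obtain ⟨C, q, hC, hq0, hq1, h⟩ := exists_mul_pow_mul_rpow_le
      (by positivity : 0 < c₀ + 1) hx0 hx1
    exact ⟨C, q, hC, hq0, hq1, fun N hN t ht γ hγ => (hlt N hN t ht γ hγ).le.trans (h N hN)⟩
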